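/- Let $X$ be a separable (real or complex) Hilbert space and let $A:D(A)\subset X\to X$ be a positive self-adjoint operator with compact resolvent. Let $X^{1/2}=D(A^{1/2})$ with the norm $\|u\|_{1/2}=\|A^{1/2}u\|$, let $\alpha>0$, and let $f:X^{1/2}\times X\to X$ satisfy, for some $L>0$, $$\|f(u_1,v_1)-f(u_2,v_2)\|\le L\left(\|u_1-u_2\|_{1/2}^2+\|v_1-v_2\|^2\right)^{1/2}\qquad\text{for all }u_1,u_2\in X^{1/2},\ v_1,v_2\in X.$$ Consider the strongly damped hyperbolic equation $$\ddot u(t)+\alpha A\dot u(t)+Au(t)=f(u(t),\dot u(t)).\tag{1}$$ In $\mathbf X=X^{1/2}\times X$, with the norm $(\|u\|_{1/2}^2+\|v\|^2)^{1/2}$, let $\mathbf A(u,v)=(v,-A(\alpha v+u))$ with domain $D(\mathbf A)=\{(u,v)\in\mathbf X:\ \alpha v+u\in D(A),\ v\in X^{1/2}\}$, and let $\mathbf F(u,v)=(0,f(u,v))$. A solution of (1) on an interval is a function $u$ with values in $X^{1/2}$, differentiable as a function into $X$, such that $z=(u,\dot u)$ is a mild solution of $\dot z=\mathbf Az+\mathbf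 F(z)$, i.e. $z$ is continuous into $\mathbf X$ and $$z(t)=e^{(t-t_0)\mathbf A}z(t_0)+\int_{t_0}^{t}e^{(t-s)\mathbf A}\mathbf F(z(s))\,ds\qquad\text{for all }t_0<t\text{ in the interval},$$ where $(e^{t\mathbf A})_{t\ge0}$ is the $C_0$-semigroup on $\mathbf X$ generated by $\mathbf A$. **Theorem.** Let $T>0$ and let $u$ be a nonstationary (that is, nonconstant) $T$-periodic solution of (1), i.e. a nonconstant solution on $[0,T]$ with $u(T)=u(0)$ and $\dot u(T)=\dot u(0)$. Then $$T\ \ge\ \frac{1}{L\left(1+\sqrt{\left(1+\tfrac1{\sqrt2}\right)\left(1+\tfrac{2}{\alpha L}\right)}\right)^{2}}.$$ -/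

import Mathlib

open Set Filter Topology

noncomputable section

namespace DampedWave

/-- A (densely defined, unbounded) operator `A : D(A) → X` on a Hilbert space that is self-adjoint,
positive and has compact resolvent. `IsSelfAdjoint` is Mathlib's notion for partially defined
operators (`A† = A`); it contains the density of the domain.

The resolvent is compact if `(ξ - A)⁻¹` is an everywhere defined compact operator for one (then for
every) point `ξ` of the resolvent set; as `A` is self-adjoint and positive, `ξ` may be taken
real. -/
structure PosOp (𝕜 X : Type*) [RCLike 𝕜] [NormedAddCommGroup X] [InnerProductSpace 𝕜 X]
    [CompleteSpace X] where
  /-- The underlying partially defined linear operator. -/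
  op : X →ₗ.[𝕜] X
  selfAdjoint : IsSelfAdjoint op
  pos : ∀ x : op.domain, (x : X) ≠ 0 → 0 < RCLike.re (inner 𝕜 (op x) (x : X))
  compact_resolvent : ∃ (ξ : ℝ) (R : X →L[𝕜] X), IsCompactOperator R ∧
    (∀ y : X, ∃ h : R y ∈ op.domain, (ξ : 𝕜) • R y - op ⟨R y, h⟩ = y) ∧
    (∀ x : op.domain, R ((ξ : 𝕜) • (x : X) - op x) = x)

namespace PosOp

variable {𝕜 X : Type*} [RCLike 𝕜] [NormedAddCommGroup X] [InnerProductSpace 𝕜 X]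
  [CompleteSpace X] (A : PosOp 𝕜 X)

/-- `ker (A - lam)`: all `x ∈ D(A)` with `A x = lam x`, i.e. `(x, lam x)` lies in the graph. -/
def eigenspace (lam : ℝ) : Submodule 𝕜 X :=
  A.op.graph.comap (LinearMap.prod LinearMap.id ((lam : 𝕜) • LinearMap.id))

theorem mem_eigenspace {lam : ℝ} {x : X} :
    x ∈ A.eigenspace lam ↔ ∃ h : x ∈ A.op.domain, A.op ⟨x, h⟩ = (lam : 𝕜) • x := by
  simp [eigenspace, LinearPMap.mem_graph_iff]

theorem isClosed_eigenspace (lam : ℝ) : IsClosed (A.eigenspace lam : Set X) := by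
  have h : IsClosed (A.op.graph : Set (X × X)) := A.selfAdjoint.isClosed
  have hc : Continuous fun x : X => (x, (lam : 𝕜) • x) := by fun_prop
  exact h.preimage hc

instance (lam : ℝ) : CompleteSpace (A.eigenspace lam) :=
  (A.isClosed_eigenspace lam).completeSpace_coe

/-- The orthogonal projection of `X` onto `ker (A - lam)`; it is zero unless `lam` is an
eigenvalue. -/
def proj (lam : ℝ) : X →L[𝕜] X := (A.eigenspace lam).starProjection

/-- The square root `A^{1/2}` given by the spectral resolution of `A` (whose spectrum consists of
positive eigenvalues): `A^{1/2} x = ∑ √lam P_lam x`, where `P_lam` is the orthogonal projection onto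
`ker (A - lam)`. The domain is the set of those `x` for which the series converges in `X`; the
terms are pairwise orthogonal, so this means that `∑ lam ‖P_lam x‖²` is finite. -/
def sqrtOp : X →ₗ.[𝕜] X where
  domain :=
    { carrier := {x | Summable fun lam : ℝ => (Real.sqrt lam : 𝕜) • A.proj lam x}
      zero_mem' := by simp [summable_zero]
      add_mem' := fun {a b} ha hb => by
        have := Summable.add ha hb
        simpa [smul_add] using this
      smul_mem' := fun c x hx => by
        have := Summable.const_smul c hx
        simpa [smul_comm c] using this }
  toFun :=
    { toFun := fun x => ∑' lam : ℝ, (Real.sqrt lam : 𝕜) • A.proj lam x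
      map_add' := fun x y => by
        rw [← Summable.tsum_add x.2 y.2]
        simp [smul_add]
      map_smul' := fun c x => by
        rw [RingHom.id_apply, ← tsum_const_smul'' c]
        simp [smul_comm c] }

theorem inner_op_comm (x y : A.op.domain) :
    inner 𝕜 (A.op x) (y : X) = inner 𝕜 (x : X) (A.op y) := by
  have h := LinearPMap.adjoint_isFormalAdjoint A.selfAdjoint.dense_domain
  rw [LinearPMap.isSelfAdjoint_def.mp A.selfAdjoint] at h
  exact h x y

theorem proj_proj {lam mu : ℝ} (h : lam ≠ mu) (x : X) : A.proj mu (A.proj lam x) = 0 := by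
  have hx : A.proj lam x ∈ A.eigenspace lam := Submodule.starProjection_apply_mem _ _
  obtain ⟨h1, h1'⟩ := A.mem_eigenspace.mp hx
  refine (Submodule.starProjection_apply_eq_zero_iff _).mpr ?_
  rw [Submodule.mem_orthogonal]
  intro y hy
  obtain ⟨h2, h2'⟩ := A.mem_eigenspace.mp hy
  have key := A.inner_op_comm ⟨y, h2⟩ ⟨_, h1⟩
  rw [h1', h2', inner_smul_left, inner_smul_right, RCLike.conj_ofReal] at key
  have h3 : ((mu : 𝕜) - (lam : 𝕜)) * inner 𝕜 y (A.proj lam x) = 0 := by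
    rw [sub_mul, sub_eq_zero]; exact key
  rcases mul_eq_zero.mp h3 with h4 | h4
  · exact absurd (by exact_mod_cast (sub_eq_zero.mp h4).symm) h
  · exact h4

/-- The eigenvectors of `A` are total: a vector orthogonal to all of them is zero. -/
theorem eq_zero_of_proj {x : X} (hx : ∀ lam : ℝ, 0 < lam → A.proj lam x = 0) : x = 0 := by
  obtain ⟨ξ, R, hR, h1, h2⟩ := A.compact_resolvent
  have hsymm : (R : X →ₗ[𝕜] X).IsSymmetric := by
    intro a b
    obtain ⟨ha, ha'⟩ := h1 a
    obtain ⟨hb, hb'⟩ := h1 b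
    have := A.inner_op_comm ⟨_, ha⟩ ⟨_, hb⟩
    simp only [ContinuousLinearMap.coe_coe]
    conv_lhs => rw [← hb']
    conv_rhs => rw [← ha']
    simp only [inner_sub_left, inner_sub_right, inner_smul_left, inner_smul_right,
      RCLike.conj_ofReal]
    rw [← this]
  have horth : x ∈ (⨆ μ : 𝕜, Module.End.eigenspace (R : X →ₗ[𝕜] X) μ)ᗮ := by
    rw [← Submodule.iInf_orthogonal, Submodule.mem_iInf]
    intro μ
    rw [Submodule.mem_orthogonal]
    intro y hy
    by_cases hy0 : y = 0
    · simp [hy0]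
    have hyR : R y = μ • y := by simpa using Module.End.mem_eigenspace_iff.mp hy
    obtain ⟨hd, hd'⟩ := h1 y
    have hμ : μ ≠ 0 := by
      rintro rfl
      apply hy0
      have h0 : (⟨R y, hd⟩ : A.op.domain) = 0 := by ext; simp [hyR]
      rw [h0] at hd'
      simpa [hyR] using hd'.symm
    have hμr : (starRingEnd 𝕜) μ = μ := hsymm.conj_eigenvalue_eq_self
      (Module.End.hasEigenvalue_of_hasEigenvector ⟨hy, hy0⟩)
    obtain ⟨m, rfl⟩ := RCLike.conj_eq_iff_real.mp hμr
    have hyd : y ∈ A.op.domain := by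
      have : y = (m : 𝕜)⁻¹ • R y := by rw [hyR, smul_smul, inv_mul_cancel₀ hμ, one_smul]
      rw [this]; exact A.op.domain.smul_mem _ hd
    have hm : (⟨R y, hd⟩ : A.op.domain) = (m : 𝕜) • ⟨y, hyd⟩ := by ext; simp [hyR]
    rw [hm, LinearPMap.map_smul, hyR] at hd'
    have hA : A.op ⟨y, hyd⟩ = ((ξ - m⁻¹ : ℝ) : 𝕜) • y := by
      have h5 : (m : 𝕜) • A.op ⟨y, hyd⟩ = (ξ : 𝕜) • (m : 𝕜) • y - y := by
        rw [eq_sub_iff_add_eq, ← eq_sub_iff_add_eq', hd']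
      calc A.op ⟨y, hyd⟩ = (m : 𝕜)⁻¹ • (m : 𝕜) • A.op ⟨y, hyd⟩ := by
            rw [smul_smul, inv_mul_cancel₀ hμ, one_smul]
        _ = _ := by
            rw [h5, smul_sub, smul_smul, smul_smul, ← sub_smul]
            congr 1
            push_cast
            field_simp
    have hmem : y ∈ A.eigenspace (ξ - m⁻¹) := A.mem_eigenspace.mpr ⟨hyd, hA⟩
    have hposl : 0 < ξ - m⁻¹ := by
      have := A.pos ⟨y, hyd⟩ hy0
      rw [hA, inner_smul_left, RCLike.conj_ofReal, RCLike.re_ofReal_mul,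
        inner_self_eq_norm_sq] at this
      exact pos_of_mul_pos_left this (by positivity)
    have hx' := (Submodule.starProjection_apply_eq_zero_iff _).mp (hx _ hposl)
    exact (Submodule.mem_orthogonal _ _).mp hx' y hmem
  rw [ContinuousLinearMap.orthogonalComplement_iSup_eigenspaces_eq_bot hR hsymm] at horth
  exact (Submodule.mem_bot 𝕜).mp horth

theorem proj_sqrtOp (mu : ℝ) (x : A.sqrtOp.domain) :
    A.proj mu (A.sqrtOp x) = (Real.sqrt mu : 𝕜) • A.proj mu (x : X) := by
  have hx : Summable fun lam : ℝ => (Real.sqrt lam : 𝕜) • A.proj lam (x : X) := x.2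
  change A.proj mu (∑' lam : ℝ, (Real.sqrt lam : 𝕜) • A.proj lam (x : X)) = _
  rw [ContinuousLinearMap.map_tsum _ hx, tsum_eq_single mu]
  · rw [map_smul]
    congr 1
    exact Submodule.starProjection_eq_self_iff.mpr (Submodule.starProjection_apply_mem _ _)
  · intro lam hlam
    rw [map_smul, A.proj_proj hlam, smul_zero]

theorem sqrtOp_injective : Function.Injective A.sqrtOp.toFun := by
  rw [← LinearMap.ker_eq_bot, LinearMap.ker_eq_bot']
  intro x hx
  ext
  refine A.eq_zero_of_proj fun lam hlam => ?_
  have h := A.proj_sqrtOp lam x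
  change A.proj lam (A.sqrtOp.toFun x) = _ at h
  rw [hx, map_zero] at h
  refine (smul_eq_zero.mp h.symm).resolve_left ?_
  exact_mod_cast (Real.sqrt_pos.mpr hlam).ne'

/-- The fractional space `X^{1/2} = D(A^{1/2})`, carrying the norm `‖u‖_{1/2} = ‖A^{1/2} u‖`
(see `PosOp.norm_XHalf`). -/
def XHalf : Type _ := A.sqrtOp.domain

instance : AddCommGroup A.XHalf := inferInstanceAs (AddCommGroup A.sqrtOp.domain)

instance : Module 𝕜 A.XHalf := inferInstanceAs (Module 𝕜 A.sqrtOp.domain)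

/-- `A^{1/2} : X^{1/2} → X`. -/
def sqrtMap : A.XHalf →ₗ[𝕜] X := A.sqrtOp.toFun

/-- The inclusion `X^{1/2} ⊆ X`. -/
def incl : A.XHalf →ₗ[𝕜] X := A.sqrtOp.domain.subtype

instance : NormedAddCommGroup A.XHalf :=
  NormedAddCommGroup.induced A.XHalf X A.sqrtMap A.sqrtOp_injective

theorem norm_XHalf (u : A.XHalf) : ‖u‖ = ‖A.sqrtMap u‖ := rfl

instance : NormedSpace 𝕜 A.XHalf := NormedSpace.induced 𝕜 A.XHalf X A.sqrtMap

section RealStructure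

variable [NormedSpace ℝ X] [IsScalarTower ℝ 𝕜 X]

/- The real scalar multiplication on `X^{1/2}` is that of `X`. -/
instance : Module ℝ A.XHalf := inferInstanceAs (Module ℝ A.sqrtOp.domain)

instance : IsScalarTower ℝ 𝕜 A.XHalf := inferInstanceAs (IsScalarTower ℝ 𝕜 A.sqrtOp.domain)

instance : NormedSpace ℝ A.XHalf where
  norm_smul_le r u := by
    have h : r • u = (r : 𝕜) • u := by
      rw [← RCLike.algebraMap_eq_ofReal, algebraMap_smul]
    rw [h, norm_smul, RCLike.norm_ofReal, Real.norm_eq_abs]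

end RealStructure

/-- The energy space `X^{1/2} × X` with the norm `‖(u, v)‖ = (‖u‖_{1/2}² + ‖v‖²)^{1/2}`. -/
abbrev EnergySpace : Type _ := WithLp 2 (A.XHalf × X)

/-- `(u, v) ↦ α v + u`. -/
def combo (α : ℝ) : A.EnergySpace →ₗ[𝕜] X where
  toFun z := (α : 𝕜) • z.snd + A.incl z.fst
  map_add' y z := by
    simp only [WithLp.add_snd, WithLp.add_fst, map_add, smul_add]
    abel
  map_smul' c z := by
    simp only [WithLp.smul_snd, WithLp.smul_fst, map_smul, smul_add, smul_comm c,
      RingHom.id_apply]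

/-- `(u, v) ↦ v`. -/
def velocity : A.EnergySpace →ₗ[𝕜] X where
  toFun z := z.snd
  map_add' _ _ := rfl
  map_smul' _ _ := rfl

/-- The domain `{(u, v) | α v + u ∈ D(A), v ∈ X^{1/2}}` of the hyperbolic operator. -/
def hyperbolicDomain (α : ℝ) : Submodule 𝕜 A.EnergySpace :=
  A.op.domain.comap (A.combo α) ⊓ A.sqrtOp.domain.comap A.velocity

/-- First component of the hyperbolic operator: `(u, v) ↦ v`, as a map into `X^{1/2}`. -/
def hyperbolicFst (α : ℝ) : A.hyperbolicDomain α →ₗ[𝕜] A.XHalf :=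
  LinearMap.codRestrict A.sqrtOp.domain (A.velocity.comp (A.hyperbolicDomain α).subtype)
    fun z => z.2.2

/-- Second component of the hyperbolic operator: `(u, v) ↦ -A (α v + u)`. -/
def hyperbolicSnd (α : ℝ) : A.hyperbolicDomain α →ₗ[𝕜] X :=
  -(A.op.toFun.comp (LinearMap.codRestrict A.op.domain
    ((A.combo α).comp (A.hyperbolicDomain α).subtype) fun z => z.2.1))

/-- The hyperbolic operator `(u, v) ↦ (v, -A (α v + u))` in `X^{1/2} × X` with the domain
`{(u, v) | α v + u ∈ D(A), v ∈ X^{1/2}}`. -/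
def hyperbolicOp (α : ℝ) : A.EnergySpace →ₗ.[𝕜] A.EnergySpace where
  domain := A.hyperbolicDomain α
  toFun := (WithLp.linearEquiv 2 𝕜 (A.XHalf × X)).symm.toLinearMap.comp
    ((A.hyperbolicFst α).prod (A.hyperbolicSnd α))

end PosOp

section Semigroup

variable {𝕜 E : Type*} [RCLike 𝕜] [NormedAddCommGroup E] [NormedSpace 𝕜 E]

/-- `S` is a `C₀`-semigroup of bounded linear operators on `E`. -/
structure IsC0Semigroup (S : NNReal → E →L[𝕜] E) : Prop where
  map_zero : S 0 = ContinuousLinearMap.id 𝕜 E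
  map_add : ∀ s t : NNReal, S (s + t) = (S s).comp (S t)
  tendsto : ∀ x : E, Tendsto (fun t : NNReal => S t x) (𝓝 0) (𝓝 x)

/-- `B` is the infinitesimal generator of `S`: `x ∈ D(B)` and `B x = y` if and only if
`(S t x - x) / t → y` as `t → 0+`. -/
def IsGenerator (B : E →ₗ.[𝕜] E) (S : NNReal → E →L[𝕜] E) : Prop :=
  ∀ x y : E, (x, y) ∈ B.graph ↔
    Tendsto (fun t : NNReal => ((t : ℝ) : 𝕜)⁻¹ • (S t x - x)) (𝓝[>] 0) (𝓝 y)

open Classical in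
/-- `e^{tB}`, `t ≥ 0`: the (unique) `C₀`-semigroup generated by `B`. If `B` does not generate a
`C₀`-semigroup, the value is `0`. -/
def expSemigroup (B : E →ₗ.[𝕜] E) : NNReal → E →L[𝕜] E :=
  if h : ∃ S : NNReal → E →L[𝕜] E, IsC0Semigroup S ∧ IsGenerator B S then h.choose else 0

/-- `z` is a mild solution of `ż = B z + F(z)` on the interval `I`: it is continuous there and
`z(t) = e^{(t - t₀)B} z(t₀) + ∫_{t₀}^t e^{(t - s)B} F(z(s)) ds` for all `t₀ < t` in `I`. -/
structure IsMildSolution [NormedSpace ℝ E] (B : E →ₗ.[𝕜] E) (F : E → E) (I : Set ℝ)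
    (z : ℝ → E) : Prop where
  continuousOn : ContinuousOn z I
  duhamel : ∀ t₀ ∈ I, ∀ t ∈ I, t₀ < t →
    z t = expSemigroup B (t - t₀).toNNReal (z t₀) +
      ∫ s in t₀..t, expSemigroup B (t - s).toNNReal (F (z s))

end Semigroup

namespace PosOp

variable {𝕜 X : Type*} [RCLike 𝕜] [NormedAddCommGroup X] [InnerProductSpace 𝕜 X]
  [CompleteSpace X] [NormedSpace ℝ X] [IsScalarTower ℝ 𝕜 X] (A : PosOp 𝕜 X)

/-- `u`, with time derivative `u̇ = v`, is a (mild) solution of `ü + α A u̇ + A u = f(u, u̇)` on the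
interval `I`: `v` is the derivative of `u` in `X` and `z = (u, v)` is a mild solution in
`X^{1/2} × X` of `ż = 𝐀 z + (0, f(z))`, where `𝐀` is the hyperbolic operator. -/
structure IsWaveSolution (α : ℝ) (f : A.XHalf → X → X) (I : Set ℝ)
    (u : ℝ → A.XHalf) (v : ℝ → X) : Prop where
  hasDeriv : ∀ t ∈ I, HasDerivWithinAt (fun s => A.incl (u s)) (v t) I t
  mild : IsMildSolution (A.hyperbolicOp α) (fun z => WithLp.toLp 2 (0, f z.fst z.snd)) I
    (fun t => WithLp.toLp 2 (u t, v t))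

end PosOp

end DampedWave

end

/-! The argument is an energy estimate carried out separately on each eigenspace of `A`. There the
equation reads `p̈ + αλṗ + λp = g`, with `p` and `g` the components of `u` and of `f(u, u̇)`. Let
`P`, `Q`, `R` be the square integrals over a period of `p` minus its mean, of `ṗ` and of `p̈`.
Periodicity makes `ṗ` orthogonal to `p` and `p̈`, and gives `⟨p̈, p⟩ = -Q`. Hence the left side
minus its mean has square integral `R + (α²λ² - 2λ)Q + λ²P`. With `q = Q/P` and `Q² ≤ PR` this is at
least `P((q - λ)² + α²λ²q)`, and Poincaré's inequality gives `q ≥ T⁻²`. If `q` and `λ` are of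
different size, the square is large; if they are comparable, damping supplies the bound. So for
`T(4L + 2/α) ≤ 1` the expression is at least `2L²(λP + Q)`, uniformly in `λ`
(`quadratic_mode_bound`, `mode_energy_le`).

Summing over `λ` bounds `2L²E` by the square integral of `f(u, u̇)` minus a constant, where `E` is
the square integral of the distance from `(u, u̇)` to `(mean of u, 0)`. The Lipschitz condition
bounds the same integral by `L²E`. Hence `E = 0` and `u` is constant (`period_bound`). The bound in
the theorem is weaker than `1/(4L + 2/α)` (`mul_le_one_of_lt_bound`).

A mild solution need not be differentiable in the energy space, but its spectral components are,
since a spectral projection turns `A` into multiplication by a number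
(`IsMildSolution.hasDerivAt_map`). This requires that the hyperbolic operator generate a semigroup,
which is built from the 2×2 matrix exponentials of the modes (`exists_semigroup_hyperbolicOp`). -/

noncomputable section

namespace DampedWave.PosOp

variable {𝕜 X : Type*} [RCLike 𝕜] [NormedAddCommGroup X] [InnerProductSpace 𝕜 X]
  [CompleteSpace X] (A : PosOp 𝕜 X)

/-! ### Spectral resolution -/

theorem proj_mem (lam : ℝ) (x : X) : A.proj lam x ∈ A.eigenspace lam :=
  Submodule.starProjection_apply_mem _ _

theorem proj_eq_self {lam : ℝ} {x : X} (hx : x ∈ A.eigenspace lam) : A.proj lam x = x :=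
  Submodule.starProjection_eq_self_iff.mpr hx

theorem proj_idem (lam : ℝ) (x : X) : A.proj lam (A.proj lam x) = A.proj lam x :=
  A.proj_eq_self (A.proj_mem lam x)

theorem proj_eq_zero_of_mem {lam mu : ℝ} (h : lam ≠ mu) {x : X} (hx : x ∈ A.eigenspace lam) :
    A.proj mu x = 0 := by
  rw [← A.proj_eq_self hx, A.proj_proj h]

theorem norm_proj_le (lam : ℝ) (x : X) : ‖A.proj lam x‖ ≤ ‖x‖ := by
  simpa using (A.proj lam).le_of_opNorm_le (Submodule.starProjection_norm_le _) x

theorem eq_zero_of_mem_eigenspace {lam : ℝ} (hlam : lam ≤ 0) {x : X}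
    (hx : x ∈ A.eigenspace lam) : x = 0 := by
  by_contra hx0
  obtain ⟨h, h'⟩ := A.mem_eigenspace.mp hx
  have := A.pos ⟨x, h⟩ hx0
  rw [h', inner_smul_left, RCLike.conj_ofReal, RCLike.re_ofReal_mul,
    inner_self_eq_norm_sq] at this
  nlinarith [sq_nonneg ‖x‖]

theorem proj_eq_zero {lam : ℝ} (hlam : lam ≤ 0) (x : X) : A.proj lam x = 0 :=
  A.eq_zero_of_mem_eigenspace hlam (A.proj_mem lam x)

theorem orthogonalFamily_eigenspace :
    OrthogonalFamily 𝕜 (fun lam : ℝ => A.eigenspace lam)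
      (fun lam => (A.eigenspace lam).subtypeₗᵢ) := by
  intro lam mu h x y
  have hy : A.proj lam (y : X) = 0 := A.proj_eq_zero_of_mem h.symm y.2
  have := (Submodule.starProjection_apply_eq_zero_iff _).mp hy
  exact (Submodule.mem_orthogonal _ _).mp this x x.2

theorem norm_sq_sum_of_mem {y : ℝ → X} (hy : ∀ lam, y lam ∈ A.eigenspace lam) (s : Finset ℝ) :
    ‖∑ lam ∈ s, y lam‖ ^ 2 = ∑ lam ∈ s, ‖y lam‖ ^ 2 :=
  A.orthogonalFamily_eigenspace.norm_sum (fun lam => ⟨y lam, hy lam⟩) s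

theorem summable_iff_of_mem {y : ℝ → X} (hy : ∀ lam, y lam ∈ A.eigenspace lam) :
    Summable y ↔ Summable fun lam => ‖y lam‖ ^ 2 :=
  A.orthogonalFamily_eigenspace.summable_iff_norm_sq_summable (fun lam => ⟨y lam, hy lam⟩)

theorem proj_of_hasSum {y : ℝ → X} {x : X} (hy : ∀ lam, y lam ∈ A.eigenspace lam)
    (h : HasSum y x) (lam : ℝ) : A.proj lam x = y lam := by
  have h1 := (A.proj lam).hasSum h
  refine h1.unique ?_
  convert hasSum_single lam fun mu hmu => ?_ using 1
  · exact (A.proj_eq_self (hy lam)).symm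
  · exact A.proj_eq_zero_of_mem hmu (hy mu)

theorem re_inner_proj (lam : ℝ) (x : X) :
    RCLike.re (inner 𝕜 x (A.proj lam x)) = ‖A.proj lam x‖ ^ 2 := by
  rw [← inner_self_eq_norm_sq (𝕜 := 𝕜) (A.proj lam x)]
  nth_rewrite 2 [← A.proj_idem lam x]
  unfold proj
  rw [← Submodule.inner_starProjection_left_eq_right, Submodule.starProjection_eq_self_iff.mpr
    (Submodule.starProjection_apply_mem _ _)]
  rw [← Submodule.inner_starProjection_left_eq_right]
  rw [Submodule.starProjection_eq_self_iff.mpr (Submodule.starProjection_apply_mem _ _)]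

theorem sum_norm_proj_sq_le (x : X) (s : Finset ℝ) :
    ∑ lam ∈ s, ‖A.proj lam x‖ ^ 2 ≤ ‖x‖ ^ 2 := by
  have h1 : RCLike.re (inner 𝕜 x (∑ lam ∈ s, A.proj lam x))
      = ‖∑ lam ∈ s, A.proj lam x‖ ^ 2 := by
    rw [A.norm_sq_sum_of_mem (fun lam => A.proj_mem lam x), inner_sum, map_sum]
    exact Finset.sum_congr rfl fun lam _ => A.re_inner_proj lam x
  have h2 := re_inner_le_norm (𝕜 := 𝕜) x (∑ lam ∈ s, A.proj lam x)
  rw [h1] at h2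
  rw [← A.norm_sq_sum_of_mem (fun lam => A.proj_mem lam x)]
  nlinarith [norm_nonneg x, norm_nonneg (∑ lam ∈ s, A.proj lam x)]

theorem summable_norm_proj_sq (x : X) : Summable fun lam => ‖A.proj lam x‖ ^ 2 :=
  summable_of_sum_le (fun _ => by positivity) (A.sum_norm_proj_sq_le x)

/-- A vector is determined by its spectral components. -/
theorem ext_proj {x y : X} (h : ∀ lam, 0 < lam → A.proj lam x = A.proj lam y) : x = y := by
  rw [← sub_eq_zero]
  exact A.eq_zero_of_proj fun lam hlam => by rw [map_sub, h lam hlam, sub_self]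

/-- Bessel's inequality makes the orthogonal series converge; its sum has the same components as
`x`, and the eigenvectors are total. -/
theorem hasSum_proj (x : X) : HasSum (fun lam => A.proj lam x) x := by
  obtain ⟨y, hy⟩ := (A.summable_iff_of_mem fun lam => A.proj_mem lam x).mpr
    (A.summable_norm_proj_sq x)
  have : y = x := A.ext_proj fun lam _ => A.proj_of_hasSum (fun lam => A.proj_mem lam x) hy lam
  rwa [this] at hy

theorem hasSum_norm_proj_sq (x : X) : HasSum (fun lam => ‖A.proj lam x‖ ^ 2) (‖x‖ ^ 2) := by
  have h := (innerSL 𝕜 x).hasSum (A.hasSum_proj x)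
  have h2 := RCLike.hasSum_re 𝕜 h
  simp only [innerSL_apply_apply, A.re_inner_proj, inner_self_eq_norm_sq] at h2
  exact h2

/-- A square summable family of eigenvectors is the family of spectral components of a vector. -/
theorem exists_proj_eq {y : ℝ → X} (hy : ∀ lam, y lam ∈ A.eigenspace lam)
    (h : Summable fun lam => ‖y lam‖ ^ 2) : ∃ x, ∀ lam, A.proj lam x = y lam := by
  obtain ⟨x, hx⟩ := (A.summable_iff_of_mem hy).mpr h
  exact ⟨x, A.proj_of_hasSum hy hx⟩

theorem norm_sq_le_of_proj {x : X} {C : ℝ}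
    (h : ∀ s : Finset ℝ, ∑ lam ∈ s, ‖A.proj lam x‖ ^ 2 ≤ C) : ‖x‖ ^ 2 ≤ C :=
  hasSum_le_of_sum_le (A.hasSum_norm_proj_sq x) h

theorem proj_op (lam : ℝ) (x : A.op.domain) :
    A.proj lam (A.op x) = (lam : 𝕜) • A.proj lam (x : X) := by
  have : A.proj lam (A.op x - (lam : 𝕜) • (x : X)) = 0 := by
    refine (Submodule.starProjection_apply_eq_zero_iff _).mpr ?_
    rw [Submodule.mem_orthogonal]
    intro e he
    obtain ⟨h1, h1'⟩ := A.mem_eigenspace.mp he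
    have := A.inner_op_comm ⟨e, h1⟩ x
    rw [h1', inner_smul_left, RCLike.conj_ofReal] at this
    rw [inner_sub_right, inner_smul_right, ← this, sub_self]
  rwa [map_sub, map_smul, sub_eq_zero] at this

/-- `A` has an everywhere defined bounded inverse. -/
theorem exists_inverse : ∃ G : X →L[𝕜] X, ∀ y, ∃ h : G y ∈ A.op.domain, A.op ⟨G y, h⟩ = y := by
  obtain ⟨ξ, R, hR, h1, h2⟩ := A.compact_resolvent
  suffices ∃ W : X →L[𝕜] X, ∀ y, (ξ : 𝕜) • R (W y) - W y = y by
    obtain ⟨W, hW⟩ := this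
    refine ⟨R.comp W, fun y => ?_⟩
    obtain ⟨h, h'⟩ := h1 (W y)
    refine ⟨h, ?_⟩
    rw [sub_eq_iff_eq_add'] at h'
    have h3 := hW y
    rw [h'] at h3
    simpa using h3
  by_cases hξ : ξ = 0
  · exact ⟨-ContinuousLinearMap.id 𝕜 X, fun y => by simp [hξ]⟩
  have hξ' : (ξ : 𝕜) ≠ 0 := by exact_mod_cast hξ
  -- Fredholm alternative: an eigenvector `w` of `R` for `ξ⁻¹` would give `A (R w) = ξ R w - w = 0`
  -- with `R w ≠ 0`, against positivity.
  rcases hR.hasEigenvalue_or_mem_resolventSet (inv_ne_zero hξ') with h | h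
  · obtain ⟨w, hw⟩ := h.exists_hasEigenvector
    have hw' : R w = (ξ : 𝕜)⁻¹ • w := hw.apply_eq_smul
    obtain ⟨h3, h4⟩ := h1 w
    have h5 : A.op ⟨R w, h3⟩ = 0 := by
      have : (ξ : 𝕜) • R w = w := by rw [hw', smul_smul, mul_inv_cancel₀ hξ', one_smul]
      rw [this] at h4
      simpa using h4
    have h6 : R w ≠ 0 := by
      rw [hw']
      exact smul_ne_zero (inv_ne_zero hξ') hw.2
    have := A.pos ⟨R w, h3⟩ h6
    rw [h5] at this
    simp at this
  · rw [spectrum.mem_resolventSet_iff] at h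
    obtain ⟨V, hV⟩ := h.exists_right_inv
    refine ⟨-(ξ : 𝕜)⁻¹ • V, fun y => ?_⟩
    have h3 : (ξ : 𝕜)⁻¹ • V y - R (V y) = y := by
      rw [Algebra.algebraMap_eq_smul_one] at hV
      exact DFunLike.congr_fun hV y
    change (ξ : 𝕜) • R (-(ξ : 𝕜)⁻¹ • V y) - -(ξ : 𝕜)⁻¹ • V y = y
    rw [map_smul, smul_smul, mul_neg, mul_inv_cancel₀ hξ', neg_smul, neg_smul, one_smul,
      sub_neg_eq_add, neg_add_eq_sub]
    exact h3

/-- The vector `A⁻¹ y` lies in the domain and has the same components as `x`, so it is `x`. -/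
theorem mem_op_domain_of_proj {x y : X}
    (h : ∀ lam : ℝ, 0 < lam → (lam : 𝕜) • A.proj lam x = A.proj lam y) :
    ∃ hx : x ∈ A.op.domain, A.op ⟨x, hx⟩ = y := by
  obtain ⟨G, hG⟩ := A.exists_inverse
  obtain ⟨h1, h2⟩ := hG y
  have : G y = x := by
    refine A.ext_proj fun lam hlam => ?_
    have h3 := A.proj_op lam ⟨G y, h1⟩
    rw [h2, ← h lam hlam] at h3
    have hl : (lam : 𝕜) ≠ 0 := by exact_mod_cast hlam.ne'
    exact (smul_right_injective X hl h3).symm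
  subst this
  exact ⟨h1, h2⟩

/-- The spectrum of `A` is bounded away from zero. -/
theorem exists_lower_bound : ∃ δ : ℝ, 0 < δ ∧ ∀ lam < δ, ∀ x, A.proj lam x = 0 := by
  obtain ⟨G, hG⟩ := A.exists_inverse
  refine ⟨(‖G‖ + 1)⁻¹, by positivity, fun lam hlam x => ?_⟩
  rcases le_or_gt lam 0 with h0 | h0
  · exact A.proj_eq_zero h0 x
  obtain ⟨h1, h2⟩ := hG (A.proj lam x)
  have h3 := A.proj_op lam ⟨_, h1⟩
  rw [h2, A.proj_idem] at h3
  -- On the eigenspace `A⁻¹` acts as `1/λ`, so `1/λ ≤ ‖A⁻¹‖` unless the eigenspace is trivial.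
  have h4 : ‖A.proj lam x‖ ≤ lam * (‖G‖ * ‖A.proj lam x‖) := by
    calc ‖A.proj lam x‖ = lam * ‖A.proj lam (G (A.proj lam x))‖ := by
          conv_lhs => rw [h3]
          rw [norm_smul, RCLike.norm_ofReal, abs_of_pos h0]
      _ ≤ _ := by
          gcongr
          exact (A.norm_proj_le _ _).trans (G.le_opNorm _)
  have h5 : lam * (‖G‖ + 1) < 1 := by
    rwa [lt_inv_comm₀ h0 (by positivity), lt_inv_comm₀ (by positivity) (by positivity),
      ← one_div, lt_div_iff₀ (by positivity)] at hlam
  by_contra hne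
  have h6 : 0 < ‖A.proj lam x‖ := norm_pos_iff.mpr hne
  nlinarith

/-! ### The space `X^{1/2}` -/

theorem proj_sqrtMap (lam : ℝ) (u : A.XHalf) :
    A.proj lam (A.sqrtMap u) = (Real.sqrt lam : 𝕜) • A.proj lam (A.incl u) :=
  A.proj_sqrtOp lam u

theorem incl_injective : Function.Injective A.incl := Subtype.val_injective

theorem exists_sqrtMap_eq_of_proj {x y : X}
    (h : ∀ lam, 0 < lam → A.proj lam y = (Real.sqrt lam : 𝕜) • A.proj lam x) :
    ∃ u : A.XHalf, A.incl u = x ∧ A.sqrtMap u = y := by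
  have h' : ∀ lam, A.proj lam y = (Real.sqrt lam : 𝕜) • A.proj lam x := fun lam => by
    rcases le_or_gt lam 0 with h0 | h0
    · simp [A.proj_eq_zero h0]
    · exact h lam h0
  have hs : Summable fun lam : ℝ => (Real.sqrt lam : 𝕜) • A.proj lam x := by
    simpa only [← h'] using (A.hasSum_proj y).summable
  let u : A.XHalf := (⟨x, hs⟩ : A.sqrtOp.domain)
  refine ⟨u, rfl, A.ext_proj fun lam hlam => ?_⟩
  rw [A.proj_sqrtMap, h']
  rfl

/-- Dividing the components by `√λ` preserves square summability because the spectrum stays away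
from zero. Completeness of `X^{1/2}` follows. -/
theorem sqrtMap_surjective : Function.Surjective A.sqrtMap := by
  intro y
  obtain ⟨δ, hδ, h⟩ := A.exists_lower_bound
  have hmem : ∀ lam, ((Real.sqrt lam)⁻¹ : 𝕜) • A.proj lam y ∈ A.eigenspace lam :=
    fun lam => Submodule.smul_mem _ _ (A.proj_mem lam y)
  have hsum : Summable fun lam : ℝ => ‖((Real.sqrt lam)⁻¹ : 𝕜) • A.proj lam y‖ ^ 2 := by
    refine Summable.of_nonneg_of_le (fun _ => by positivity) (fun lam => ?_)
      ((A.summable_norm_proj_sq y).mul_left δ⁻¹)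
    rcases lt_or_ge lam δ with h0 | h0
    · simp [h lam h0]
    · rw [norm_smul, mul_pow, norm_inv, RCLike.norm_ofReal, abs_of_nonneg (Real.sqrt_nonneg _),
        inv_pow, Real.sq_sqrt (hδ.le.trans h0)]
      gcongr
  obtain ⟨x, hx⟩ := A.exists_proj_eq hmem hsum
  obtain ⟨u, -, hu⟩ := A.exists_sqrtMap_eq_of_proj (x := x) (y := y) fun lam hlam => by
    have : (Real.sqrt lam : 𝕜) ≠ 0 := by exact_mod_cast (Real.sqrt_pos.mpr hlam).ne'
    rw [hx, smul_smul, mul_inv_cancel₀ this, one_smul]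
  exact ⟨u, hu⟩

/-- `A^{1/2}` as an isometric isomorphism of `X^{1/2}` onto `X`. -/
def sqrtEquiv : A.XHalf ≃ₗᵢ[𝕜] X where
  toLinearEquiv := LinearEquiv.ofBijective A.sqrtMap ⟨A.sqrtOp_injective, A.sqrtMap_surjective⟩
  norm_map' _ := rfl

instance : CompleteSpace A.XHalf :=
  (completeSpace_congr (e := A.sqrtEquiv.toEquiv)
    A.sqrtEquiv.isometry.isUniformEmbedding).mpr inferInstance

theorem proj_incl {lam : ℝ} (hlam : 0 < lam) (u : A.XHalf) :
    A.proj lam (A.incl u) = ((Real.sqrt lam)⁻¹ : 𝕜) • A.proj lam (A.sqrtMap u) := by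
  have : (Real.sqrt lam : 𝕜) ≠ 0 := by exact_mod_cast (Real.sqrt_pos.mpr hlam).ne'
  rw [A.proj_sqrtMap, smul_smul, inv_mul_cancel₀ this, one_smul]

/-- The spectral component of an element of `X^{1/2}`. -/
def projHalf (lam : ℝ) : A.XHalf →L[𝕜] X :=
  ((Real.sqrt lam)⁻¹ : 𝕜) • (A.proj lam).comp (A.sqrtEquiv : A.XHalf →L[𝕜] X)

/-- Passing through the isometry `A^{1/2}` makes continuity in the `X^{1/2}` norm immediate; for `λ
≤ 0` both sides vanish. -/
theorem projHalf_apply (lam : ℝ) (u : A.XHalf) : A.projHalf lam u = A.proj lam (A.incl u) := by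
  rcases le_or_gt lam 0 with h0 | h0
  · simp [projHalf, A.proj_eq_zero h0]
  · rw [A.proj_incl h0]
    rfl

theorem norm_proj_sqrtMap_sq (lam : ℝ) (u : A.XHalf) :
    ‖A.proj lam (A.sqrtMap u)‖ ^ 2 = lam * ‖A.proj lam (A.incl u)‖ ^ 2 := by
  rcases le_or_gt lam 0 with h0 | h0
  · simp [A.proj_eq_zero h0]
  · rw [A.proj_sqrtMap, norm_smul, mul_pow, RCLike.norm_ofReal, sq_abs, Real.sq_sqrt h0.le]

end DampedWave.PosOp

namespace DampedWave

/-! ### `C₀`-semigroups -/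

theorem tendsto_coe_nhdsGT_zero : Tendsto (fun t : NNReal => (t : ℝ)) (𝓝[>] 0) (𝓝[≠] 0) := by
  refine tendsto_nhdsWithin_iff.mpr ⟨?_, ?_⟩
  · exact (NNReal.continuous_coe.tendsto' 0 0 rfl).mono_left nhdsWithin_le_nhds
  · filter_upwards [self_mem_nhdsWithin] with t ht
    exact (NNReal.coe_pos.mpr ht).ne'

section C0

variable {𝕜 E : Type*} [RCLike 𝕜] [NormedAddCommGroup E] [NormedSpace 𝕜 E]

namespace IsC0Semigroup

variable {S : NNReal → E →L[𝕜] E}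

/-- Otherwise the norms blow up along some `tₙ → 0`, although every orbit converges there,
contradicting the uniform boundedness principle. -/
theorem exists_bound_near_zero [CompleteSpace E] (hS : IsC0Semigroup S) :
    ∃ δ : NNReal, 0 < δ ∧ ∃ M : ℝ, 1 ≤ M ∧ ∀ t ≤ δ, ‖S t‖ ≤ M := by
  by_contra! hcon
  have h1 : ∀ n : ℕ, ∃ t : NNReal, t ≤ 1 / ((n : NNReal) + 1) ∧ (n : ℝ) + 1 < ‖S t‖ := fun n =>
    hcon _ (by positivity) _ (by linarith [n.cast_nonneg (α := ℝ)])
  choose t ht htn using h1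
  have htend : Tendsto t atTop (𝓝 0) :=
    tendsto_of_tendsto_of_tendsto_of_le_of_le tendsto_const_nhds
      tendsto_one_div_add_atTop_nhds_zero_nat (fun _ => zero_le) ht
  obtain ⟨C, hC⟩ := banach_steinhaus (g := fun n => S (t n)) fun x => by
    obtain ⟨C, hC⟩ := ((hS.tendsto x).comp htend).norm.bddAbove_range
    exact ⟨C, fun n => hC ⟨n, rfl⟩⟩
  obtain ⟨n, hn⟩ := exists_nat_gt C
  linarith [htn n, hC n]

theorem exists_bound [CompleteSpace E] (hS : IsC0Semigroup S) (a : NNReal) :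
    ∃ M : ℝ, 0 ≤ M ∧ ∀ t ≤ a, ‖S t‖ ≤ M := by
  obtain ⟨δ, hδ, M, hM, h⟩ := hS.exists_bound_near_zero
  have key : ∀ n : ℕ, ∀ t ≤ n • δ, ‖S t‖ ≤ M ^ (n + 1) := by
    intro n
    induction n with
    | zero =>
      intro t ht
      have : t ≤ δ := by simpa using ht.trans (by simp)
      simpa using h t this
    | succ n ih =>
      intro t ht
      rcases le_total t δ with h1 | h1
      · exact (h t h1).trans (le_self_pow₀ hM (by omega))
      · have h2 : t - δ ≤ n • δ := by
          rw [tsub_le_iff_right, ← succ_nsmul]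
          exact ht
        have h3 : S t = (S δ).comp (S (t - δ)) := by
          rw [← hS.map_add, add_tsub_cancel_of_le h1]
        rw [h3, pow_succ']
        refine (ContinuousLinearMap.opNorm_comp_le _ _).trans ?_
        have := ih _ h2
        have := h δ le_rfl
        gcongr
  obtain ⟨n, hn⟩ := exists_nat_ge (a / δ)
  refine ⟨M ^ (n + 1), by positivity, fun t ht => key n t (ht.trans ?_)⟩
  rw [nsmul_eq_mul]
  exact (div_le_iff₀ hδ).mp hn

theorem norm_sub_le (hS : IsC0Semigroup S) {a s t : NNReal} (hs : s ≤ a) (ht : t ≤ a) {M : ℝ}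
    (hM : ∀ t ≤ a, ‖S t‖ ≤ M) (x : E) : ‖S s x - S t x‖ ≤ M * ‖S (nndist s t) x - x‖ := by
  wlog hst : s ≤ t generalizing s t
  · rw [norm_sub_rev, nndist_comm]
    exact this ht hs (le_of_not_ge hst)
  have h1 : t = s + nndist s t := by
    rw [NNReal.nndist_eq, max_eq_right, add_tsub_cancel_of_le hst]
    rw [tsub_eq_zero_of_le hst]
    exact zero_le
  have h2 : S t x = S s (S (nndist s t) x) := by
    conv_lhs => rw [h1, hS.map_add]
    rfl
  rw [h2, ← map_sub, norm_sub_rev _ x]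
  exact (S s).le_of_opNorm_le (hM s hs) _

theorem continuous_uncurry [CompleteSpace E] (hS : IsC0Semigroup S) :
    Continuous fun p : NNReal × E => S p.1 p.2 := by
  rw [continuous_iff_continuousAt]
  rintro ⟨t, x⟩
  obtain ⟨M, hM0, hM⟩ := hS.exists_bound (t + 1)
  rw [ContinuousAt, tendsto_iff_norm_sub_tendsto_zero]
  have h1 : Tendsto (fun p : NNReal × E => nndist p.1 t) (𝓝 (t, x)) (𝓝 0) := by
    have : Continuous fun p : NNReal × E => nndist p.1 t := by fun_prop
    simpa using this.tendsto (t, x)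
  have h2 : Tendsto (fun p : NNReal × E => M * ‖p.2 - x‖ + M * ‖S (nndist p.1 t) x - x‖)
      (𝓝 (t, x)) (𝓝 0) := by
    have h3 : Tendsto (fun p : NNReal × E => S (nndist p.1 t) x - x) (𝓝 (t, x)) (𝓝 0) := by
      simpa using ((hS.tendsto x).comp h1).sub_const x
    have h4 : Tendsto (fun p : NNReal × E => p.2 - x) (𝓝 (t, x)) (𝓝 0) := by
      have : Continuous fun p : NNReal × E => p.2 - x := by fun_prop
      simpa using this.tendsto (t, x)
    simpa using (h4.norm.const_mul M).add (h3.norm.const_mul M)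
  refine squeeze_zero' (Eventually.of_forall fun _ => norm_nonneg _) ?_ h2
  have hnear : ∀ᶠ p : NNReal × E in 𝓝 (t, x), p.1 < t + 1 :=
    continuous_fst.tendsto (t, x) |>.eventually (gt_mem_nhds (by simp))
  filter_upwards [hnear] with p hp
  calc ‖S p.1 p.2 - S t x‖ = ‖S p.1 (p.2 - x) + (S p.1 x - S t x)‖ := by
        rw [map_sub, sub_add_sub_cancel]
    _ ≤ _ := (norm_add_le _ _).trans (add_le_add ((S p.1).le_of_opNorm_le (hM _ hp.le) _)
        (hS.norm_sub_le hp.le (by simp) hM x))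

theorem continuous_orbit [CompleteSpace E] (hS : IsC0Semigroup S) (x : E) :
    Continuous fun s : ℝ => S s.toNNReal x :=
  hS.continuous_uncurry.comp (continuous_real_toNNReal.prodMk continuous_const)

variable [CompleteSpace E] [NormedSpace ℝ E]

/-- Near the starting point the integrand is close to `g t`, by joint continuity of `(t, x) ↦ S t
x`. The derivative at the lower endpoint suffices, since Duhamel's formula may be restarted at any
time. -/
theorem hasDerivWithinAt_convolution (hS : IsC0Semigroup S) {g : ℝ → E} {t b : ℝ} (htb : t < b)
    (hg : ContinuousOn g (Icc t b)) :
    HasDerivWithinAt (fun r : ℝ => ∫ s in t..r, S (r - s).toNNReal (g s)) (g t) (Ici t) t := by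
  have hk : ∀ r ≤ b, ContinuousOn (fun s : ℝ => S (r - s).toNNReal (g s)) (Icc t r) := by
    intro r hr
    refine hS.continuous_uncurry.comp_continuousOn (ContinuousOn.prodMk ?_ ?_)
    · exact (continuous_real_toNNReal.comp (continuous_const.sub continuous_id)).continuousOn
    · exact hg.mono (Icc_subset_Icc_right hr)
  rw [hasDerivWithinAt_iff_isLittleO, Asymptotics.isLittleO_iff]
  intro ε hε
  have hgt : Tendsto g (𝓝[≥] t) (𝓝 (g t)) :=
    (hg t (left_mem_Icc.mpr htb.le)).tendsto.mono_left
      (nhdsWithin_le_iff.mpr (Icc_mem_nhdsGE htb))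
  have hS0 : Tendsto (fun p : NNReal × E => S p.1 p.2) (𝓝 (0, g t)) (𝓝 (g t)) := by
    simpa [hS.map_zero] using hS.continuous_uncurry.tendsto (0, g t)
  have hnear : ∀ᶠ p : NNReal × E in 𝓝 0 ×ˢ 𝓝 (g t), ‖S p.1 p.2 - g t‖ < ε := by
    rw [← nhds_prod_eq]
    have := hS0.eventually (Metric.ball_mem_nhds _ hε)
    filter_upwards [this] with p hp
    rwa [← dist_eq_norm]
  obtain ⟨U, hU, V, hV, hUV⟩ := Filter.eventually_prod_iff.mp hnear
  obtain ⟨δ, hδ, hUδ⟩ := Metric.eventually_nhds_iff.mp hU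
  obtain ⟨c, hc, hVc⟩ := (mem_nhdsGE_iff_exists_Ico_subset' htb).mp (hgt.eventually hV)
  filter_upwards [Ico_mem_nhdsGE (show t < min b (min c (t + δ)) from
    lt_min htb (lt_min hc (by linarith)))] with r hr
  have hrb : r < b := hr.2.trans_le (min_le_left _ _)
  have hrc : r < c := hr.2.trans_le ((min_le_right _ _).trans (min_le_left _ _))
  have hrδ : r < t + δ := hr.2.trans_le ((min_le_right _ _).trans (min_le_right _ _))
  have hint : IntervalIntegrable (fun s : ℝ => S (r - s).toNNReal (g s))
      MeasureTheory.volume t r :=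
    ((hk r hrb.le).mono (by rw [uIcc_of_le hr.1])).intervalIntegrable
  have heq : (∫ s in t..r, S (r - s).toNNReal (g s)) - (∫ s in t..t, S (t - s).toNNReal (g s))
      - (r - t) • g t = ∫ s in t..r, (S (r - s).toNNReal (g s) - g t) := by
    rw [intervalIntegral.integral_sub hint intervalIntegrable_const,
      intervalIntegral.integral_const, intervalIntegral.integral_same, sub_zero]
  rw [heq, Real.norm_eq_abs]
  refine intervalIntegral.norm_integral_le_of_norm_le_const fun s hs => ?_
  rw [uIoc_of_le hr.1] at hs
  have hdist : dist (r - s).toNNReal 0 < δ := by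
    rw [NNReal.dist_eq, NNReal.coe_zero, sub_zero, Real.coe_toNNReal _ (by linarith [hs.2]),
      abs_of_nonneg (by linarith [hs.2])]
    linarith [hs.1]
  refine (hUV (hUδ hdist) (hVc ⟨hs.1.le, hs.2.trans_lt hrc⟩)).le

variable [IsScalarTower ℝ 𝕜 E]

/-- `S t` shifts the interval of integration, so the difference quotient is that of `t ↦ ∫₀^{h+t} -
∫₀^t` at zero. -/
theorem integral_mem_graph (hS : IsC0Semigroup S) {B : E →ₗ.[𝕜] E} (hB : IsGenerator B S) (x : E)
    {h : ℝ} (hh : 0 ≤ h) : (∫ s in (0 : ℝ)..h, S s.toNNReal x, S h.toNNReal x - x) ∈ B.graph := by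
  rw [hB]
  set o : ℝ → E := fun s => S s.toNNReal x with ho
  have hoc : Continuous o := hS.continuous_orbit x
  have hii : ∀ a b : ℝ, IntervalIntegrable o MeasureTheory.volume a b :=
    fun a b => hoc.intervalIntegrable a b
  have hshift : ∀ t : NNReal, S t (∫ s in (0 : ℝ)..h, o s) = ∫ s in (t : ℝ)..(h + t), o s := by
    intro t
    rw [← ContinuousLinearMap.intervalIntegral_comp_comm _ (hii _ _)]
    have : ∫ s in (0 : ℝ)..h, o (s + t) = ∫ s in (t : ℝ)..(h + t), o s := by
      rw [intervalIntegral.integral_comp_add_right, zero_add]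
    rw [← this]
    refine intervalIntegral.integral_congr fun s hs => ?_
    rw [uIcc_of_le hh] at hs
    have h1 : (s + (t : ℝ)).toNNReal = t + s.toNNReal := by
      rw [Real.toNNReal_add hs.1 t.coe_nonneg, Real.toNNReal_coe, add_comm]
    simp only [ho]
    rw [h1, hS.map_add]
    rfl
  have hF : ∀ a : ℝ, HasDerivAt (fun t : ℝ => ∫ s in (0 : ℝ)..t, o s) (o a) a := fun a =>
    intervalIntegral.integral_hasDerivAt_right (hii _ _)
      (hoc.stronglyMeasurableAtFilter _ _) hoc.continuousAt
  have hG : HasDerivAt (fun t : ℝ => (∫ s in (0 : ℝ)..(h + t), o s) - ∫ s in (0 : ℝ)..t, o s)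
      (o h - o 0) 0 := by
    refine HasDerivAt.sub ?_ (hF 0)
    have := hF (h + 0)
    rw [add_zero] at this
    have h2 := HasDerivAt.comp_const_add h 0 (by rw [add_zero]; exact this)
    exact h2
  have hlim := hasDerivAt_iff_tendsto_slope_zero.mp hG
  have h0 : o 0 = x := by simp [ho, hS.map_zero]
  have := hlim.comp tendsto_coe_nhdsGT_zero
  rw [h0] at this
  refine this.congr fun t => ?_
  simp only [Function.comp, zero_add, add_zero, intervalIntegral.integral_same, sub_zero]
  rw [hshift, RCLike.real_smul_eq_coe_smul (K := 𝕜), RCLike.ofReal_inv]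
  congr 1
  rw [← intervalIntegral.integral_interval_sub_left (hii 0 (h + t)) (hii 0 t)]

variable {G : Type*} [NormedAddCommGroup G] [NormedSpace 𝕜 G] [NormedSpace ℝ G] [CompleteSpace G]

/-- If `ψ ∘ B ⊆ χ` for bounded `ψ` and `χ`, then `ψ (e^{hB} x)` has the derivative
`χ (e^{hB} x)`, even if `x` is not in the domain of `B`. -/
theorem map_eq_add_integral (hS : IsC0Semigroup S) {B : E →ₗ.[𝕜] E} (hB : IsGenerator B S)
    {ψ χ : E →L[𝕜] G} (hψ : ∀ x y, (x, y) ∈ B.graph → ψ y = χ x) (x : E) {h : ℝ} (hh : 0 ≤ h) :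
    ψ (S h.toNNReal x) = ψ x + ∫ s in (0 : ℝ)..h, χ (S s.toNNReal x) := by
  have h1 := hψ _ _ (hS.integral_mem_graph hB x hh)
  rw [map_sub, sub_eq_iff_eq_add'] at h1
  rw [h1, ContinuousLinearMap.intervalIntegral_comp_comm]
  exact (hS.continuous_orbit x).intervalIntegrable _ _

theorem hasDerivWithinAt_map (hS : IsC0Semigroup S) {B : E →ₗ.[𝕜] E} (hB : IsGenerator B S)
    {ψ χ : E →L[𝕜] G} (hψ : ∀ x y, (x, y) ∈ B.graph → ψ y = χ x) (x : E) (t : ℝ) :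
    HasDerivWithinAt (fun r : ℝ => ψ (S (r - t).toNNReal x)) (χ x) (Ici t) t := by
  have hc : Continuous fun s : ℝ => χ (S s.toNNReal x) := χ.continuous.comp (hS.continuous_orbit x)
  have h1 : HasDerivAt (fun r : ℝ => ψ x + ∫ s in (0 : ℝ)..(r - t), χ (S s.toNNReal x))
      (χ x) t := by
    refine HasDerivAt.const_add _ ?_
    have h2 : HasDerivAt (fun a : ℝ => ∫ s in (0 : ℝ)..a, χ (S s.toNNReal x)) (χ x) (t - t) := by
      have := intervalIntegral.integral_hasDerivAt_right (hc.intervalIntegrable 0 (t - t))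
        (hc.stronglyMeasurableAtFilter _ _) hc.continuousAt
      simpa [hS.map_zero] using this
    exact HasDerivAt.comp_sub_const t t h2
  refine h1.hasDerivWithinAt.congr (fun r hr => ?_) ?_
  · exact hS.map_eq_add_integral hB hψ x (sub_nonneg.mpr hr)
  · simp [hS.map_zero]

end IsC0Semigroup

end C0

end DampedWave

namespace DampedWave

/-! ### Mild solutions tested against bounded functionals -/

section Mild

/-- A continuous function with a continuous right derivative is differentiable. -/
theorem hasDerivAt_of_hasDerivWithinAt_Ioi {G : Type*} [NormedAddCommGroup G] [NormedSpace ℝ G]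
    [CompleteSpace G] {a b : ℝ} {y y' : ℝ → G} (hy : ContinuousOn y (Icc a b))
    (hy' : ContinuousOn y' (Icc a b))
    (h : ∀ t ∈ Ioo a b, HasDerivWithinAt y (y' t) (Ioi t) t) {t : ℝ} (ht : t ∈ Ioo a b) :
    HasDerivAt y (y' t) t := by
  have hab : a ≤ b := (ht.1.trans ht.2).le
  have hint : ∀ r ∈ Icc a b, IntervalIntegrable y' MeasureTheory.volume a r := fun r hr =>
    (hy'.mono (by rw [uIcc_of_le hr.1]; exact Icc_subset_Icc_right hr.2)).intervalIntegrable
  have key : ∀ r ∈ Icc a b, y r = y a + ∫ s in a..r, y' s := by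
    intro r hr
    rw [intervalIntegral.integral_eq_sub_of_hasDeriv_right_of_le hr.1
      (hy.mono (Icc_subset_Icc_right hr.2))
      (fun x hx => h x ⟨hx.1, hx.2.trans_le hr.2⟩) (hint r hr)]
    abel
  have hnhds : Icc a b ∈ 𝓝 t := Icc_mem_nhds ht.1 ht.2
  have hd : HasDerivAt (fun r => y a + ∫ s in a..r, y' s) (y' t) t := by
    refine HasDerivAt.const_add _ ?_
    exact intervalIntegral.integral_hasDerivAt_right (hint t (Ioo_subset_Icc_self ht))
      ((hy'.mono Ioo_subset_Icc_self).stronglyMeasurableAtFilter isOpen_Ioo t ht)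
      (hy'.continuousAt hnhds)
  exact hd.congr_of_eventuallyEq (by filter_upwards [hnhds] with r hr using key r hr)

variable {𝕜 E : Type*} [RCLike 𝕜] [NormedAddCommGroup E] [NormedSpace 𝕜 E]

/-- Without a proof of generation the chosen semigroup could be the default value `0` and the mild
formulation would carry no information. -/
theorem expSemigroup_spec {B : E →ₗ.[𝕜] E}
    (h : ∃ S : NNReal → E →L[𝕜] E, IsC0Semigroup S ∧ IsGenerator B S) :
    IsC0Semigroup (expSemigroup B) ∧ IsGenerator B (expSemigroup B) := by
  rw [expSemigroup, dif_pos h]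
  exact h.choose_spec

variable {G : Type*} [NormedAddCommGroup G] [NormedSpace 𝕜 G] [NormedSpace ℝ G]

/-- The bounded map `χ` extends `ψ ∘ B` to the whole space, so `ψ ∘ z` solves the differential
equation although `z` may leave the domain of `B`. Restarting Duhamel's formula at each `r` gives a
right derivative; its continuity makes it two-sided. -/
theorem IsMildSolution.hasDerivAt_map [NormedSpace ℝ E] [IsScalarTower ℝ 𝕜 E] [CompleteSpace E] [CompleteSpace G]
    [IsScalarTower ℝ 𝕜 G]
    {B : E →ₗ.[𝕜] E} (hB : ∃ S : NNReal → E →L[𝕜] E, IsC0Semigroup S ∧ IsGenerator B S)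
    {F : E → E} (hF : Continuous F) {a b : ℝ} {z : ℝ → E} (hz : IsMildSolution B F (Icc a b) z)
    {ψ χ : E →L[𝕜] G} (hψ : ∀ x y, (x, y) ∈ B.graph → ψ y = χ x) {t : ℝ} (ht : t ∈ Ioo a b) :
    HasDerivAt (fun r => ψ (z r)) (χ (z t) + ψ (F (z t))) t := by
  obtain ⟨hS, hgen⟩ := expSemigroup_spec hB
  have hFz : ContinuousOn (fun r => F (z r)) (Icc a b) := hF.comp_continuousOn hz.continuousOn
  refine hasDerivAt_of_hasDerivWithinAt_Ioi (y' := fun t => χ (z t) + ψ (F (z t)))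
    (ψ.continuous.comp_continuousOn hz.continuousOn)
    ((χ.continuous.comp_continuousOn hz.continuousOn).add (ψ.continuous.comp_continuousOn hFz))
    (fun r hr => ?_) ht
  have h1 := hS.hasDerivWithinAt_map hgen hψ (z r) r
  have h2 := hS.hasDerivWithinAt_convolution hr.2 (hFz.mono (Icc_subset_Icc_left hr.1.le))
  let ψR : E →L[ℝ] G := ψ.restrictScalars ℝ
  have h3 := ψR.hasFDerivAt.comp_hasDerivWithinAt r h2
  refine ((h1.add h3).mono Ioi_subset_Ici_self).congr_of_eventuallyEq ?_ ?_
  · filter_upwards [Ioc_mem_nhdsGT hr.2] with s hs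
    rw [Function.comp_apply, hz.duhamel r (Ioo_subset_Icc_self hr) s ⟨hr.1.le.trans hs.1.le, hs.2⟩ hs.1, map_add]
    rfl
  · simp [hS.map_zero]

end Mild

end DampedWave

namespace DampedWave

/-! ### The energy inequality for one mode -/

section Mode

open MeasureTheory intervalIntegral

variable {H : Type*} [NormedAddCommGroup H] [InnerProductSpace ℝ H]

theorem continuousOn_intervalIntegrable {E : Type*} [NormedAddCommGroup E] {T : ℝ} (hT : 0 ≤ T)
    {y : ℝ → E} (hy : ContinuousOn y (Icc 0 T)) : IntervalIntegrable y volume 0 T :=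
  (by rwa [uIcc_of_le hT] : ContinuousOn y (uIcc 0 T)).intervalIntegrable

/-- Integration by parts for periodic functions. -/
theorem integral_inner_add_inner_eq_zero {T : ℝ} (hT : 0 ≤ T) {x y x' y' : ℝ → H}
    (hx : ContinuousOn x (Icc 0 T)) (hy : ContinuousOn y (Icc 0 T))
    (hx' : ContinuousOn x' (Icc 0 T)) (hy' : ContinuousOn y' (Icc 0 T))
    (hdx : ∀ t ∈ Ioo 0 T, HasDerivAt x (x' t) t) (hdy : ∀ t ∈ Ioo 0 T, HasDerivAt y (y' t) t)
    (hpx : x T = x 0) (hpy : y T = y 0) :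
    ∫ t in (0 : ℝ)..T, (inner ℝ (x t) (y' t) + inner ℝ (x' t) (y t)) = 0 := by
  rw [integral_eq_sub_of_hasDerivAt_of_le hT (f := fun t => inner ℝ (x t) (y t)) (hx.inner hy)
    (fun t ht => (hdx t ht).inner ℝ (hdy t ht))
    (continuousOn_intervalIntegrable hT ((hx.inner hy').add (hx'.inner hy)))]
  rw [hpx, hpy, sub_self]

/-- The Poincaré inequality. -/
theorem integral_norm_sq_sub_le {T : ℝ} (hT : 0 < T) {p b : ℝ → H} [CompleteSpace H]
    (hp : ContinuousOn p (Icc 0 T)) (hb : ContinuousOn b (Icc 0 T))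
    (hd : ∀ t ∈ Ioo 0 T, HasDerivAt p (b t) t) :
    ∫ t in (0 : ℝ)..T, ‖p t - p 0‖ ^ 2 ≤ T ^ 2 * ∫ t in (0 : ℝ)..T, ‖b t‖ ^ 2 := by
  set m : ℝ := (∫ t in (0 : ℝ)..T, ‖b t‖) with hm
  set Q : ℝ := ∫ t in (0 : ℝ)..T, ‖b t‖ ^ 2 with hQ
  have hin := continuousOn_intervalIntegrable hT.le hb.norm
  have hin2 : IntervalIntegrable (fun t => ‖b t‖ ^ 2) volume 0 T :=
    continuousOn_intervalIntegrable hT.le (hb.norm.pow 2)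
  have hcs : m ^ 2 ≤ T * Q := by
    -- Cauchy–Schwarz, read off from the nonnegative variance of `‖b‖`.
    have h0 : 0 ≤ ∫ t in (0 : ℝ)..T, (‖b t‖ - m / T) ^ 2 :=
      integral_nonneg hT.le fun _ _ => sq_nonneg _
    have h1 : ∫ t in (0 : ℝ)..T, (‖b t‖ - m / T) ^ 2
        = Q - 2 * (m / T) * m + T * (m / T) ^ 2 := by
      have : ∀ t, (‖b t‖ - m / T) ^ 2 = ‖b t‖ ^ 2 - 2 * (m / T) * ‖b t‖ + (m / T) ^ 2 :=
        fun t => by ring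
      simp_rw [this]
      rw [integral_add (hin2.sub (hin.const_mul _)) intervalIntegrable_const,
        integral_sub hin2 (hin.const_mul _), intervalIntegral.integral_const_mul,
        intervalIntegral.integral_const, smul_eq_mul, sub_zero]
    rw [h1] at h0
    have h2 : Q - 2 * (m / T) * m + T * (m / T) ^ 2 = (T * Q - m ^ 2) / T := by
      field_simp
      ring
    rw [h2] at h0
    have := (div_nonneg_iff.mp h0).resolve_right fun h => absurd h.2 (by linarith)
    linarith [this.1]
  have hbound : ∀ t ∈ Icc 0 T, ‖p t - p 0‖ ^ 2 ≤ T * Q := by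
    intro t ht
    have h1 : p t - p 0 = ∫ s in (0 : ℝ)..t, b s := by
      rw [integral_eq_sub_of_hasDerivAt_of_le ht.1 (hp.mono (Icc_subset_Icc_right ht.2))
        (fun s hs => hd s ⟨hs.1, hs.2.trans_le ht.2⟩)
        (continuousOn_intervalIntegrable ht.1 (hb.mono (Icc_subset_Icc_right ht.2)))]
    have h2 : ‖p t - p 0‖ ≤ m := by
      rw [h1]
      refine (intervalIntegral.norm_integral_le_integral_norm ht.1).trans ?_
      exact integral_mono_interval le_rfl ht.1 ht.2
        (Eventually.of_forall fun _ => norm_nonneg _) hin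
    exact (pow_le_pow_left₀ (norm_nonneg _) h2 2).trans hcs
  calc ∫ t in (0 : ℝ)..T, ‖p t - p 0‖ ^ 2 ≤ ∫ _ in (0 : ℝ)..T, T * Q :=
        integral_mono_on hT.le
          (continuousOn_intervalIntegrable hT.le ((hp.sub continuousOn_const).norm.pow 2))
          intervalIntegrable_const hbound
    _ = T ^ 2 * Q := by rw [intervalIntegral.integral_const, smul_eq_mul]; ring

theorem integral_norm_sub_sq {T : ℝ} (hT : 0 ≤ T) [CompleteSpace H] {y : ℝ → H}
    (hy : ContinuousOn y (Icc 0 T)) (c : H) :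
    ∫ t in (0 : ℝ)..T, ‖y t - c‖ ^ 2 = (∫ t in (0 : ℝ)..T, ‖y t‖ ^ 2)
      - 2 * inner ℝ (∫ t in (0 : ℝ)..T, y t) c + T * ‖c‖ ^ 2 := by
  have h2 : IntervalIntegrable (fun t => ‖y t‖ ^ 2) volume 0 T :=
    continuousOn_intervalIntegrable hT (hy.norm.pow 2)
  have h3 : IntervalIntegrable (fun t => inner ℝ (y t) c) volume 0 T :=
    continuousOn_intervalIntegrable hT (hy.inner continuousOn_const)
  simp_rw [norm_sub_sq_real]
  rw [integral_add (h2.sub (h3.const_mul _)) intervalIntegrable_const,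
    integral_sub h2 (h3.const_mul _), intervalIntegral.integral_const_mul,
    intervalIntegral.integral_const, smul_eq_mul, sub_zero]
  congr 3
  have := (innerSL ℝ c).intervalIntegral_comp_comm (continuousOn_intervalIntegrable hT hy)
  simp only [innerSL_apply_apply] at this
  rw [real_inner_comm, ← this]
  simp only [real_inner_comm]

/-- The square integral about the mean is minimal. -/
theorem integral_norm_sq_le_of_integral_eq_zero {T : ℝ} (hT : 0 ≤ T) [CompleteSpace H]
    {y : ℝ → H} (hy : ContinuousOn y (Icc 0 T)) (h0 : ∫ t in (0 : ℝ)..T, y t = 0) (c : H) :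
    ∫ t in (0 : ℝ)..T, ‖y t‖ ^ 2 ≤ ∫ t in (0 : ℝ)..T, ‖y t - c‖ ^ 2 := by
  rw [integral_norm_sub_sq hT hy, h0, inner_zero_left]
  nlinarith [sq_nonneg ‖c‖]

/-- The elementary inequality behind the energy estimate: `P`, `Q`, `R` are the square integrals of
a mean free function and of its first two derivatives. -/
theorem quadratic_mode_bound {α L T lam P Q R : ℝ} (hα : 0 < α) (hL : 0 < L) (hT : 0 < T)
    (hTL : T * (4 * L + 2 / α) ≤ 1) (hlam : 0 < lam) (hP : 0 ≤ P) (hR : 0 ≤ R)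
    (hPQ : P ≤ T ^ 2 * Q) (hQR : ∀ s : ℝ, 0 ≤ R - 2 * s * Q + s ^ 2 * P) :
    2 * L ^ 2 * (lam * P + Q) ≤ R + (α ^ 2 * lam ^ 2 - 2 * lam) * Q + lam ^ 2 * P := by
  have hQ : 0 ≤ Q := by
    by_contra! h
    nlinarith [mul_pos (pow_pos hT 2) (neg_pos.mpr h)]
  rcases hP.eq_or_lt with h0 | h0
  -- If `P = 0`, the family of inequalities is affine in `s`, which forces `Q = 0`; the chosen `s`
  -- would give `R - (R + 1) ≥ 0`.
  · have hQ0 : Q = 0 := by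
      by_contra hne
      have hpos : 0 < Q := lt_of_le_of_ne hQ (Ne.symm hne)
      have := hQR ((R + 1) / (2 * Q))
      rw [← h0] at this
      have h1 : 2 * ((R + 1) / (2 * Q)) * Q = R + 1 := by field_simp
      rw [h1] at this
      linarith
    rw [hQ0, ← h0]
    simpa using hR
  obtain ⟨q, rfl⟩ : ∃ q, Q = q * P := ⟨Q / P, by field_simp⟩
  have hqT : 1 ≤ T ^ 2 * q := by
    have : 1 * P ≤ (T ^ 2 * q) * P := by linarith
    exact le_of_mul_le_mul_right this h0
  have hRq : q ^ 2 * P ≤ R := by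
    have := hQR q
    nlinarith
  have hq0 : 0 < q := by
    by_contra! h
    nlinarith [mul_nonneg (pow_pos hT 2).le (neg_nonneg.mpr h)]
  -- Poincaré gives `q ≥ T⁻²`. Expanding the square then yields both `q ≥ 16L²` and, from the cross
  -- term, `αq ≥ 16L`.
  have hσ : (4 * L + 2 / α) ^ 2 ≤ q := by
    have h1 : (T * (4 * L + 2 / α)) ^ 2 ≤ 1 := pow_le_one₀ (by positivity) hTL
    have h2 : T ^ 2 * (4 * L + 2 / α) ^ 2 ≤ T ^ 2 * q := by rw [← mul_pow]; linarith
    exact le_of_mul_le_mul_left h2 (by positivity)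
  have hexp : (4 * L + 2 / α) ^ 2 = 16 * L ^ 2 + 16 * (L / α) + 4 * (1 / α) ^ 2 := by
    field_simp
    ring
  have hLα : 0 < L / α := by positivity
  have hq1 : 16 * L ^ 2 ≤ q := by nlinarith [sq_nonneg (1 / α)]
  have hq2 : 16 * L ≤ α * q := by
    have : 16 * (L / α) ≤ q := by nlinarith [sq_nonneg (1 / α), sq_nonneg L]
    calc 16 * L = α * (16 * (L / α)) := by field_simp
      _ ≤ α * q := by gcongr
  have hq3 : 256 * L ^ 2 ≤ α ^ 2 * q ^ 2 := by
    have := pow_le_pow_left₀ (by positivity) hq2 2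
    nlinarith
  suffices h : 2 * L ^ 2 * (lam + q) ≤ (q - lam) ^ 2 + α ^ 2 * lam ^ 2 * q by
    have := mul_le_mul_of_nonneg_right h h0.le
    nlinarith
  have hα2 : 0 ≤ α ^ 2 * lam ^ 2 * q := by positivity
  -- Off resonance (`q ≥ 2λ` or `λ ≥ 2q`) the square `(q - λ)²` is at least a quarter of the larger
  -- number squared, and `q ≥ 16L²` suffices. In between, `λ ≥ q/2` gives `α²λ² ≥ 64L²`, so damping
  -- dominates `2L²(λ + q) ≤ 6L²q`.
  rcases le_total (2 * lam) q with hc | hc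
  · nlinarith [mul_le_mul_of_nonneg_left hq1 hq0.le, sq_nonneg L]
  rcases le_total lam (2 * q) with hc' | hc'
  · have h1 : q ^ 2 ≤ 4 * lam ^ 2 := by nlinarith
    have h2 : 64 * L ^ 2 ≤ α ^ 2 * lam ^ 2 := by
      have := mul_le_mul_of_nonneg_left h1 (sq_nonneg α)
      nlinarith
    have h3 := mul_le_mul_of_nonneg_right h2 hq0.le
    have h4 := mul_le_mul_of_nonneg_left hc' (sq_nonneg L)
    nlinarith [sq_nonneg (q - lam), sq_nonneg L]
  · have h1 := mul_le_mul_of_nonneg_right hq1 hlam.le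
    have h2 := mul_le_mul_of_nonneg_left hc' (sq_nonneg L)
    nlinarith [mul_le_mul_of_nonneg_right hc' hlam.le]

/-- The energy estimate for one mode `p̈ + α λ ṗ + λ p = g` of a periodic solution. -/
theorem mode_energy_le [CompleteSpace H] {α L T lam : ℝ} (hα : 0 < α) (hL : 0 < L) (hT : 0 < T)
    (hTL : T * (4 * L + 2 / α) ≤ 1) (hlam : 0 < lam) {p b g : ℝ → H}
    (hp : ContinuousOn p (Icc 0 T)) (hb : ContinuousOn b (Icc 0 T))
    (hg : ContinuousOn g (Icc 0 T)) (hdp : ∀ t ∈ Ioo 0 T, HasDerivAt p (b t) t)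
    (hdb : ∀ t ∈ Ioo 0 T, HasDerivAt b (g t - (α * lam) • b t - lam • p t) t)
    (hpp : p T = p 0) (hpb : b T = b 0) {pm : H} (hpm : ∫ t in (0 : ℝ)..T, (p t - pm) = 0)
    (c : H) :
    2 * L ^ 2 * (lam * (∫ t in (0 : ℝ)..T, ‖p t - pm‖ ^ 2) + ∫ t in (0 : ℝ)..T, ‖b t‖ ^ 2)
      ≤ ∫ t in (0 : ℝ)..T, ‖g t - c‖ ^ 2 := by
  set q : ℝ → H := fun t => p t - pm with hq
  set b' : ℝ → H := fun t => g t - (α * lam) • b t - lam • p t with hb'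
  have hqc : ContinuousOn q (Icc 0 T) := hp.sub continuousOn_const
  have hb'c : ContinuousOn b' (Icc 0 T) := by fun_prop
  have hdq : ∀ t ∈ Ioo 0 T, HasDerivAt q (b t) t := fun t ht => (hdp t ht).sub_const pm
  have hpq : q T = q 0 := by simp [hq, hpp]
  have ii : ∀ {y : ℝ → ℝ}, ContinuousOn y (Icc 0 T) → IntervalIntegrable y volume 0 T :=
    fun hy => continuousOn_intervalIntegrable hT.le hy
  have iH : ∀ {y : ℝ → H}, ContinuousOn y (Icc 0 T) → IntervalIntegrable y volume 0 T :=
    fun hy => continuousOn_intervalIntegrable hT.le hy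
  -- the three orthogonality relations
  have e1 : ∫ t in (0 : ℝ)..T, inner ℝ (b t) (q t) = 0 := by
    have := integral_inner_add_inner_eq_zero hT.le hqc hqc hb hb hdq hdq hpq hpq
    simp_rw [fun t => real_inner_comm (b t) (q t), ← two_mul] at this
    rw [intervalIntegral.integral_const_mul] at this
    linarith
  have e2 : ∫ t in (0 : ℝ)..T, inner ℝ (b' t) (b t) = 0 := by
    have := integral_inner_add_inner_eq_zero hT.le hb hb hb'c hb'c hdb hdb hpb hpb
    simp_rw [fun t => real_inner_comm (b' t) (b t), ← two_mul] at this
    rw [intervalIntegral.integral_const_mul] at this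
    linarith
  set Q : ℝ := ∫ t in (0 : ℝ)..T, ‖b t‖ ^ 2 with hQ
  set P : ℝ := ∫ t in (0 : ℝ)..T, ‖q t‖ ^ 2 with hP
  set R : ℝ := ∫ t in (0 : ℝ)..T, ‖b' t‖ ^ 2 with hR
  have e3 : ∫ t in (0 : ℝ)..T, inner ℝ (b' t) (q t) = -Q := by
    have := integral_inner_add_inner_eq_zero hT.le hb hqc hb'c hb hdb hdq hpb hpq
    rw [integral_add (ii (hb.inner hb)) (ii (hb'c.inner hqc))] at this
    simp_rw [real_inner_self_eq_norm_sq] at this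
    linarith
  -- the square integral of a combination
  have hcomb : ∀ r s : ℝ, ∫ t in (0 : ℝ)..T, ‖b' t + r • b t + s • q t‖ ^ 2
      = R + (r ^ 2 - 2 * s) * Q + s ^ 2 * P := by
    intro r s
    have hpt : ∀ t, ‖b' t + r • b t + s • q t‖ ^ 2 = ‖b' t‖ ^ 2 + r ^ 2 * ‖b t‖ ^ 2
        + s ^ 2 * ‖q t‖ ^ 2 + 2 * r * inner ℝ (b' t) (b t) + 2 * s * inner ℝ (b' t) (q t)
        + 2 * (r * s) * inner ℝ (b t) (q t) := by
      intro t
      rw [norm_add_sq_real, norm_add_sq_real, inner_add_left, norm_smul, norm_smul, mul_pow,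
        mul_pow, inner_smul_left, inner_smul_right, inner_smul_right, inner_smul_right]
      simp only [Real.norm_eq_abs, sq_abs, conj_trivial]
      ring
    simp_rw [hpt]
    have i1 : IntervalIntegrable (fun t => ‖b' t‖ ^ 2) volume 0 T := ii (hb'c.norm.pow 2)
    have i2 : IntervalIntegrable (fun t => r ^ 2 * ‖b t‖ ^ 2) volume 0 T :=
      (ii (hb.norm.pow 2)).const_mul (r ^ 2)
    have i3 : IntervalIntegrable (fun t => s ^ 2 * ‖q t‖ ^ 2) volume 0 T :=
      (ii (hqc.norm.pow 2)).const_mul (s ^ 2)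
    have i4 := (ii (hb'c.inner (𝕜 := ℝ) hb)).const_mul (2 * r)
    have i5 := (ii (hb'c.inner (𝕜 := ℝ) hqc)).const_mul (2 * s)
    have i6 := (ii (hb.inner (𝕜 := ℝ) hqc)).const_mul (2 * (r * s))
    rw [integral_add ((((i1.add i2).add i3).add i4).add i5) i6,
      integral_add (((i1.add i2).add i3).add i4) i5, integral_add ((i1.add i2).add i3) i4,
      integral_add (i1.add i2) i3, integral_add i1 i2]
    simp only [intervalIntegral.integral_const_mul, e1, e2, e3]
    ring
  -- The Poincaré estimate is about the initial value; replacing that by the mean only decreases the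
  -- left side.
  have hPQ : P ≤ T ^ 2 * Q := by
    refine le_trans ?_ (integral_norm_sq_sub_le hT hqc hb hdq)
    exact integral_norm_sq_le_of_integral_eq_zero hT.le hqc hpm _
  have hmain := quadratic_mode_bound hα hL hT hTL hlam
    (integral_nonneg hT.le fun t _ => sq_nonneg ‖q t‖)
    (integral_nonneg hT.le fun t _ => sq_nonneg ‖b' t‖) hPQ fun s => by
      have h1 := hcomb 0 s
      have h2 : 0 ≤ ∫ t in (0 : ℝ)..T, ‖b' t + (0 : ℝ) • b t + s • q t‖ ^ 2 :=
        integral_nonneg hT.le fun _ _ => sq_nonneg _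
      rw [h1] at h2
      linarith
  refine hmain.trans ?_
  have h3 := hcomb (α * lam) lam
  rw [mul_pow] at h3
  rw [← h3]
  have hmean : ∫ t in (0 : ℝ)..T, (b' t + (α * lam) • b t + lam • q t) = 0 := by
    have i2 : IntervalIntegrable (fun t => (α * lam) • b t) volume 0 T :=
      iH (hb.const_smul (α * lam))
    have i3 : IntervalIntegrable (fun t => lam • q t) volume 0 T := iH (hqc.const_smul lam)
    rw [integral_add ((iH hb'c).add i2) i3, integral_add (iH hb'c) i2,
      intervalIntegral.integral_smul, intervalIntegral.integral_smul, hpm,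
      integral_eq_sub_of_hasDerivAt_of_le hT.le hb hdb (iH hb'c),
      integral_eq_sub_of_hasDerivAt_of_le hT.le hp hdp (iH hb), hpp, hpb]
    simp
  have hsum : ContinuousOn (fun t => b' t + (α * lam) • b t + lam • q t) (Icc 0 T) := by fun_prop
  -- By the equation, `g - c` is the mean-free combination minus the constant `c - λ pm`.
  refine (integral_norm_sq_le_of_integral_eq_zero hT.le hsum hmean (c - lam • pm)).trans
    (le_of_eq (integral_congr fun t _ => ?_))
  simp only [hb', hq, smul_sub]
  congr 2
  abel

end Mode

end DampedWave

/-! ### Summation over the modes and rigidity of short-period solutions -/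

namespace DampedWave

open MeasureTheory intervalIntegral

/-- Dini's theorem makes the increasing net of partial sums converge uniformly. It needs no
countability of the index set, which will be all of `ℝ`. -/
theorem integral_le_of_hasSum {ι : Type*} {T C : ℝ} (hT : 0 ≤ T) {φ : ι → ℝ → ℝ} {Φ : ℝ → ℝ}
    (hφ0 : ∀ i t, 0 ≤ φ i t) (hφ : ∀ i, ContinuousOn (φ i) (Icc 0 T))
    (hΦ : ContinuousOn Φ (Icc 0 T)) (hsum : ∀ t ∈ Icc 0 T, HasSum (fun i => φ i t) (Φ t))
    (hC : ∀ s : Finset ι, ∫ t in (0 : ℝ)..T, ∑ i ∈ s, φ i t ≤ C) :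
    ∫ t in (0 : ℝ)..T, Φ t ≤ C := by
  classical
  have hcont : ∀ s : Finset ι, ContinuousOn (fun t => ∑ i ∈ s, φ i t) (Icc 0 T) := fun s =>
    continuousOn_finsetSum s fun i _ => hφ i
  have hunif := Monotone.tendstoUniformlyOn_of_forall_tendsto (F := fun s t => ∑ i ∈ s, φ i t)
    (f := Φ) isCompact_Icc hcont
    (fun t _ s s' h => Finset.sum_le_sum_of_subset_of_nonneg h fun i _ _ => hφ0 i t) hΦ
    (fun t ht => hsum t ht)
  refine le_of_forall_pos_le_add fun ε hε => ?_
  obtain ⟨s, hs⟩ := (Metric.tendstoUniformlyOn_iff.mp hunif (ε / (T + 1)) (by positivity)).exists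
  calc ∫ t in (0 : ℝ)..T, Φ t ≤ ∫ t in (0 : ℝ)..T, ((∑ i ∈ s, φ i t) + ε / (T + 1)) := by
        refine integral_mono_on hT (continuousOn_intervalIntegrable hT hΦ)
          (continuousOn_intervalIntegrable hT ((hcont s).add continuousOn_const)) fun t ht => ?_
        have := hs t ht
        rw [Real.dist_eq] at this
        linarith [le_abs_self (Φ t - ∑ i ∈ s, φ i t)]
    _ = (∫ t in (0 : ℝ)..T, ∑ i ∈ s, φ i t) + T * (ε / (T + 1)) := by
        rw [integral_add (continuousOn_intervalIntegrable hT (hcont s)) intervalIntegrable_const,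
          intervalIntegral.integral_const, smul_eq_mul, sub_zero]
    _ ≤ C + ε := by
        refine add_le_add (hC s) ?_
        rw [mul_div_assoc', div_le_iff₀ (by positivity)]
        nlinarith

theorem eq_zero_of_integral_le_zero {T : ℝ} (hT : 0 < T) {Φ : ℝ → ℝ} (h0 : ∀ t, 0 ≤ Φ t)
    (hΦ : ContinuousOn Φ (Icc 0 T)) (h : ∫ t in (0 : ℝ)..T, Φ t ≤ 0) {t : ℝ}
    (ht : t ∈ Icc 0 T) : Φ t = 0 := by
  by_contra hne
  exact (integral_pos hT hΦ (fun x _ => h0 x)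
    ⟨t, ht, lt_of_le_of_ne (h0 t) (Ne.symm hne)⟩).not_ge h

/-- The real inner product underlying a real or complex inner product. -/
abbrev realInnerProductSpace (𝕜 X : Type*) [RCLike 𝕜] [NormedAddCommGroup X]
    [InnerProductSpace 𝕜 X] [NormedSpace ℝ X] [IsScalarTower ℝ 𝕜 X] : InnerProductSpace ℝ X where
  inner x y := RCLike.re (inner 𝕜 x y)
  norm_sq_eq_re_inner x := norm_sq_eq_re_inner (𝕜 := 𝕜) x
  conj_inner_symm x y := inner_re_symm y x
  add_left x y z := by rw [inner_add_left, map_add]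
  smul_left x y r := by
    rw [RCLike.real_smul_eq_coe_smul (K := 𝕜), inner_smul_left, RCLike.conj_ofReal,
      RCLike.re_ofReal_mul]
    rfl

namespace PosOp

variable {𝕜 X : Type*} [RCLike 𝕜] [NormedAddCommGroup X] [InnerProductSpace 𝕜 X]
  [CompleteSpace X] (A : PosOp 𝕜 X)

theorem mem_graph_hyperbolicOp {α : ℝ} {z w : A.EnergySpace} :
    (z, w) ∈ (A.hyperbolicOp α).graph ↔ A.incl w.fst = z.snd ∧
      ∃ h : (α : 𝕜) • z.snd + A.incl z.fst ∈ A.op.domain, A.op ⟨_, h⟩ = -w.snd := by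
  rw [LinearPMap.mem_graph_iff]
  constructor
  · rintro ⟨⟨z', hz'⟩, rfl, rfl⟩
    refine ⟨rfl, hz'.1, ?_⟩
    change _ = -(-(A.op _))
    rw [neg_neg]
    rfl
  · rintro ⟨h1, h2, h3⟩
    have hz : z ∈ A.hyperbolicDomain α := ⟨h2, by
      change z.snd ∈ A.sqrtOp.domain
      rw [← h1]
      exact w.fst.2⟩
    refine ⟨⟨z, hz⟩, rfl, ?_⟩
    refine WithLp.ofLp_injective 2 (Prod.ext ?_ ?_)
    · exact A.incl_injective h1.symm
    · rw [eq_neg_iff_add_eq_zero, add_comm, ← eq_neg_iff_add_eq_zero] at h3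
      exact h3.symm

/-- The spectral component of the velocity. -/
def velocityProj (lam : ℝ) : A.EnergySpace →L[𝕜] X :=
  (A.proj lam).comp (WithLp.sndL 2 𝕜 A.XHalf X)

/-- The spectral component of the second entry of the hyperbolic operator. -/
def forceProj (α lam : ℝ) : A.EnergySpace →L[𝕜] X :=
  -(((α * lam : ℝ) : 𝕜) • A.velocityProj lam +
    (lam : 𝕜) • (A.projHalf lam).comp (WithLp.fstL 2 𝕜 A.XHalf X))

/-- This is the relation `ψ ∘ B ⊆ χ` with bounded `ψ` and `χ` that `IsMildSolution.hasDerivAt_map`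
requires. -/
theorem velocityProj_of_mem_graph {α : ℝ} (lam : ℝ) {z w : A.EnergySpace}
    (h : (z, w) ∈ (A.hyperbolicOp α).graph) : A.velocityProj lam w = A.forceProj α lam z := by
  obtain ⟨-, h2, h3⟩ := A.mem_graph_hyperbolicOp.mp h
  have h4 := A.proj_op lam ⟨_, h2⟩
  rw [h3] at h4
  change A.proj lam w.snd = -(((α * lam : ℝ) : 𝕜) • A.proj lam z.snd
    + (lam : 𝕜) • A.projHalf lam z.fst)
  rw [A.projHalf_apply]
  rw [map_neg, map_add, map_smul, smul_add, smul_smul, neg_eq_iff_eq_neg] at h4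
  rw [h4]
  push_cast
  rw [mul_comm (α : 𝕜)]

variable [NormedSpace ℝ X] [IsScalarTower ℝ 𝕜 X]

/-- A periodic wave solution of short period is constant. -/
theorem period_bound {α L T : ℝ} (hα : 0 < α)
    (hgen : ∃ S : NNReal → A.EnergySpace →L[𝕜] A.EnergySpace,
      IsC0Semigroup S ∧ IsGenerator (A.hyperbolicOp α) S)
    {f : A.XHalf → X → X} (hL : 0 < L)
    (hf : ∀ (u₁ u₂ : A.XHalf) (v₁ v₂ : X),
      ‖f u₁ v₁ - f u₂ v₂‖ ≤ L * Real.sqrt (‖u₁ - u₂‖ ^ 2 + ‖v₁ - v₂‖ ^ 2))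
    (hT : 0 < T) {u : ℝ → A.XHalf} {v : ℝ → X} (hsol : A.IsWaveSolution α f (Icc 0 T) u v)
    (hu : u T = u 0) (hv : v T = v 0) (hTL : T * (4 * L + 2 / α) ≤ 1) :
    ∀ t ∈ Icc 0 T, u t = u 0 := by
  -- The estimates for one mode use a real inner product; its real part version induces the same
  -- norm.
  let _ : InnerProductSpace ℝ X := realInnerProductSpace 𝕜 X
  have hzc := hsol.mild.continuousOn
  have huc : ContinuousOn u (Icc 0 T) :=
    (WithLp.fstL 2 𝕜 A.XHalf X).continuous.comp_continuousOn hzc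
  have hvc : ContinuousOn v (Icc 0 T) :=
    (WithLp.sndL 2 𝕜 A.XHalf X).continuous.comp_continuousOn hzc
  have hfsq : ∀ (u₁ u₂ : A.XHalf) (v₁ v₂ : X),
      ‖f u₁ v₁ - f u₂ v₂‖ ^ 2 ≤ L ^ 2 * (‖u₁ - u₂‖ ^ 2 + ‖v₁ - v₂‖ ^ 2) := by
    intro u₁ u₂ v₁ v₂
    have := pow_le_pow_left₀ (norm_nonneg _) (hf u₁ u₂ v₁ v₂) 2
    rwa [mul_pow, Real.sq_sqrt (by positivity)] at this
  have hfc : Continuous fun z : A.EnergySpace => f z.fst z.snd := by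
    refine (LipschitzWith.of_dist_le_mul (K := L.toNNReal) fun z w => ?_).continuous
    rw [Real.coe_toNNReal _ hL.le, dist_eq_norm, dist_eq_norm, WithLp.prod_norm_eq_of_L2]
    exact hf _ _ _ _
  have hFc : Continuous fun z : A.EnergySpace =>
      (WithLp.toLp 2 ((0 : A.XHalf), f z.fst z.snd) : A.EnergySpace) :=
    (WithLp.prod_continuous_toLp 2 A.XHalf X).comp (continuous_const.prodMk hfc)
  -- The reference state is `(um, 0)`: the mode estimate needs the mean of `u`, and allows any
  -- constant to be subtracted from the force, here `f um 0`.
  set um : A.XHalf := T⁻¹ • ∫ t in (0 : ℝ)..T, u t with hum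
  set h : ℝ → X := fun t => f (u t) (v t) - f um 0 with hh
  set w : ℝ → X := fun t => A.sqrtMap (u t - um) with hw
  have hfuv : ContinuousOn (fun t => f (u t) (v t)) (Icc 0 T) := hfc.comp_continuousOn hzc
  have hhc : ContinuousOn h (Icc 0 T) := hfuv.sub continuousOn_const
  have hwc : ContinuousOn w (Icc 0 T) :=
    A.sqrtEquiv.continuous.comp_continuousOn (huc.sub continuousOn_const)
  have hpc : ∀ (lam : ℝ) {y : ℝ → X}, ContinuousOn y (Icc 0 T) →
      ContinuousOn (fun t => A.proj lam (y t)) (Icc 0 T) := fun lam y hy =>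
    (A.proj lam).continuous.comp_continuousOn hy
  -- the energy inequality for each mode
  have hmode : ∀ lam : ℝ, 2 * L ^ 2 *
      (∫ t in (0 : ℝ)..T, (‖A.proj lam (w t)‖ ^ 2 + ‖A.proj lam (v t)‖ ^ 2))
        ≤ ∫ t in (0 : ℝ)..T, ‖A.proj lam (h t)‖ ^ 2 := by
    intro lam
    rcases le_or_gt lam 0 with h0 | h0
    · simp [A.proj_eq_zero h0]
    have hpu : ContinuousOn (fun t => A.projHalf lam (u t)) (Icc 0 T) :=
      (A.projHalf lam).continuous.comp_continuousOn huc
    have hmean : ∫ t in (0 : ℝ)..T, (A.projHalf lam (u t) - A.projHalf lam um) = 0 := by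
      rw [integral_sub (continuousOn_intervalIntegrable hT.le hpu) intervalIntegrable_const,
        ContinuousLinearMap.intervalIntegral_comp_comm _
          (continuousOn_intervalIntegrable hT.le huc), intervalIntegral.integral_const, sub_zero,
        hum]
      rw [RCLike.real_smul_eq_coe_smul (K := 𝕜) T⁻¹, map_smul, RCLike.real_smul_eq_coe_smul (K := 𝕜),
        smul_smul, ← RCLike.ofReal_mul, mul_inv_cancel₀ hT.ne', RCLike.ofReal_one, one_smul,
        sub_self]
    have key := mode_energy_le hα hL hT hTL h0 (p := fun t => A.projHalf lam (u t))
      (b := fun t => A.proj lam (v t)) (g := fun t => A.proj lam (f (u t) (v t)))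
      hpu (hpc lam hvc) (hpc lam hfuv)
      (fun t ht => by
        have h1 := (hsol.hasDeriv t (Ioo_subset_Icc_self ht)).hasDerivAt (Icc_mem_nhds ht.1 ht.2)
        have h2 := ((A.proj lam).restrictScalars ℝ).hasFDerivAt.comp_hasDerivAt t h1
        simp only [A.projHalf_apply]
        exact h2)
      (fun t ht => by
        have h1 : HasDerivAt (fun t => A.proj lam (v t))
            (-(((α * lam : ℝ) : 𝕜) • A.proj lam (v t) + (lam : 𝕜) • A.projHalf lam (u t))
              + A.proj lam (f (u t) (v t))) t :=
          hsol.mild.hasDerivAt_map hgen hFc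
            (fun x y hxy => A.velocityProj_of_mem_graph lam hxy) ht
        convert h1 using 1
        rw [← RCLike.real_smul_eq_coe_smul (K := 𝕜), ← RCLike.real_smul_eq_coe_smul (K := 𝕜)]
        abel)
      (by simp only [hu]) (by simp only [hv]) hmean (A.proj lam (f um 0))
    have i1 : IntervalIntegrable (fun t => ‖A.proj lam (w t)‖ ^ 2) volume 0 T :=
      continuousOn_intervalIntegrable hT.le ((hpc lam hwc).norm.pow 2)
    have i2 : IntervalIntegrable (fun t => ‖A.proj lam (v t)‖ ^ 2) volume 0 T :=
      continuousOn_intervalIntegrable hT.le ((hpc lam hvc).norm.pow 2)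
    rw [integral_add i1 i2]
    have hw2 : ∀ t, ‖A.proj lam (w t)‖ ^ 2
        = lam * ‖A.projHalf lam (u t) - A.projHalf lam um‖ ^ 2 := fun t => by
      rw [hw, A.norm_proj_sqrtMap_sq, ← A.projHalf_apply, map_sub]
    simp_rw [hw2, intervalIntegral.integral_const_mul]
    simpa only [hh, map_sub] using key
  -- summation over the modes
  have hPhi : ContinuousOn (fun t => ‖w t‖ ^ 2 + ‖v t‖ ^ 2) (Icc 0 T) := by fun_prop
  have hh2 : IntervalIntegrable (fun t => ‖h t‖ ^ 2) volume 0 T :=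
    continuousOn_intervalIntegrable hT.le (hhc.norm.pow 2)
  have hsum : 2 * L ^ 2 * ∫ t in (0 : ℝ)..T, (‖w t‖ ^ 2 + ‖v t‖ ^ 2)
      ≤ ∫ t in (0 : ℝ)..T, ‖h t‖ ^ 2 := by
    -- Finite sums of mode inequalities are controlled on the right by Bessel's inequality; the left
    -- side then passes to the limit.
    rw [← le_div_iff₀' (by positivity)]
    refine integral_le_of_hasSum hT.le
      (φ := fun lam t => ‖A.proj lam (w t)‖ ^ 2 + ‖A.proj lam (v t)‖ ^ 2)
      (fun _ _ => by positivity)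
      (fun lam => ((hpc lam hwc).norm.pow 2).add ((hpc lam hvc).norm.pow 2)) hPhi
      (fun t _ => (A.hasSum_norm_proj_sq _).add (A.hasSum_norm_proj_sq _)) fun s => ?_
    have i1 : ∀ lam ∈ s, IntervalIntegrable
        (fun t => ‖A.proj lam (w t)‖ ^ 2 + ‖A.proj lam (v t)‖ ^ 2) volume 0 T := fun lam _ =>
      continuousOn_intervalIntegrable hT.le
        (((hpc lam hwc).norm.pow 2).add ((hpc lam hvc).norm.pow 2))
    have i2 : ∀ lam ∈ s, IntervalIntegrable (fun t => ‖A.proj lam (h t)‖ ^ 2) volume 0 T :=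
      fun lam _ => continuousOn_intervalIntegrable hT.le ((hpc lam hhc).norm.pow 2)
    rw [le_div_iff₀' (by positivity), intervalIntegral.integral_finsetSum i1, Finset.mul_sum]
    refine (Finset.sum_le_sum fun lam _ => hmode lam).trans ?_
    rw [← intervalIntegral.integral_finsetSum i2]
    exact integral_mono_on hT.le (continuousOn_intervalIntegrable hT.le
      (continuousOn_finsetSum s fun lam _ => (hpc lam hhc).norm.pow 2)) hh2
      fun t _ => A.sum_norm_proj_sq_le _ s
  have hlip : ∫ t in (0 : ℝ)..T, ‖h t‖ ^ 2
      ≤ L ^ 2 * ∫ t in (0 : ℝ)..T, (‖w t‖ ^ 2 + ‖v t‖ ^ 2) := by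
    rw [← intervalIntegral.integral_const_mul]
    refine integral_mono_on hT.le hh2
      ((continuousOn_intervalIntegrable hT.le hPhi).const_mul _) fun t _ => ?_
    have := hfsq (u t) um (v t) 0
    rw [sub_zero] at this
    exact this
  -- With `E` the integral, `2L²E ≤ L²E`.
  have hle : ∫ t in (0 : ℝ)..T, (‖w t‖ ^ 2 + ‖v t‖ ^ 2) ≤ 0 := by
    have h1 := hsum.trans hlip
    have h2 : 0 < L ^ 2 := by positivity
    by_contra! hpos
    nlinarith [mul_pos h2 hpos]
  have hconst : ∀ t ∈ Icc 0 T, u t = um := fun t ht => by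
    have h1 := eq_zero_of_integral_le_zero hT (fun t => by positivity) hPhi hle ht
    have h2 : ‖w t‖ ^ 2 = 0 := by nlinarith [sq_nonneg ‖w t‖, sq_nonneg ‖v t‖]
    have h3 : ‖u t - um‖ = 0 := by
      rw [A.norm_XHalf]
      exact pow_eq_zero_iff two_ne_zero |>.mp h2
    exact sub_eq_zero.mp (norm_eq_zero.mp h3)
  intro t ht
  rw [hconst t ht, hconst 0 (left_mem_Icc.mpr hT.le)]

end PosOp

/-- Comparison of the bound on the period with an elementary one. -/
theorem mul_le_one_of_lt_bound {α L T : ℝ} (hα : 0 < α) (hL : 0 < L)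
    (h : T < 1 / (L * (1 + Real.sqrt ((1 + 1 / Real.sqrt 2) * (1 + 2 / (α * L)))) ^ 2)) :
    T * (4 * L + 2 / α) ≤ 1 := by
  set x : ℝ := (1 + 1 / Real.sqrt 2) * (1 + 2 / (α * L)) with hx
  have h1 : 1 + 2 / (α * L) ≤ x := by
    have : 0 ≤ 1 / Real.sqrt 2 := by positivity
    exact le_mul_of_one_le_left (by positivity) (by linarith)
  have h2 : 0 ≤ 2 / (α * L) := by positivity
  have h3 : 1 ≤ Real.sqrt x := Real.one_le_sqrt.mpr (by linarith)
  -- `(1 + √x)² = 1 + 2√x + x ≥ 3 + x`, and `x ≥ 1 + 2/(αL)`.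
  have h4 : 4 + 2 / (α * L) ≤ (1 + Real.sqrt x) ^ 2 := by
    have := Real.sq_sqrt (show 0 ≤ x by linarith)
    nlinarith
  have h5 : 4 * L + 2 / α ≤ L * (1 + Real.sqrt x) ^ 2 := by
    calc 4 * L + 2 / α = L * (4 + 2 / (α * L)) := by field_simp
      _ ≤ _ := by gcongr
  rcases le_or_gt T 0 with hT | hT
  · have : 0 ≤ 4 * L + 2 / α := by positivity
    nlinarith
  · rw [lt_div_iff₀ (by positivity)] at h
    exact (mul_le_mul_of_nonneg_left h5 hT.le).trans h.le

end DampedWave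

namespace DampedWave

/-! ### The matrix exponential of one mode -/

/-- The matrix of the damped oscillator with the frequency `√lam`. -/
def oscMatrix (α lam : ℝ) : Matrix (Fin 2) (Fin 2) ℝ :=
  !![0, Real.sqrt lam; -Real.sqrt lam, -(α * lam)]

/-- The fundamental matrix of the damped oscillator. -/
def oscFlow (α lam t : ℝ) : Matrix (Fin 2) (Fin 2) ℝ :=
  NormedSpace.exp (t • oscMatrix α lam)

theorem oscFlow_zero (α lam : ℝ) : oscFlow α lam 0 = 1 := by
  simp [oscFlow]

theorem oscFlow_add (α lam s t : ℝ) :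
    oscFlow α lam (s + t) = oscFlow α lam s * oscFlow α lam t := by
  rw [oscFlow, add_smul, Matrix.exp_add_of_commute]
  · rfl
  · exact (Commute.refl _).smul_left s |>.smul_right t

section

open scoped Matrix.Norms.Operator

theorem hasDerivAt_oscFlow (α lam t : ℝ) (i j : Fin 2) :
    HasDerivAt (fun t => oscFlow α lam t i j) ((oscFlow α lam t * oscMatrix α lam) i j) t := by
  have h := hasDerivAt_exp_smul_const (𝕂 := ℝ) (oscMatrix α lam) t
  exact (hasDerivAt_pi.mp (hasDerivAt_pi.mp h i) j)

theorem hasDerivAt_oscFlow_left (α lam t : ℝ) (i j : Fin 2) :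
    HasDerivAt (fun t => oscFlow α lam t i j) ((oscMatrix α lam * oscFlow α lam t) i j) t := by
  have h := hasDerivAt_exp_smul_const' (𝕂 := ℝ) (oscMatrix α lam) t
  exact (hasDerivAt_pi.mp (hasDerivAt_pi.mp h i) j)

end

theorem continuous_oscFlow (α lam : ℝ) (i j : Fin 2) :
    Continuous fun t => oscFlow α lam t i j :=
  continuous_iff_continuousAt.mpr fun t => (hasDerivAt_oscFlow α lam t i j).continuousAt

/-- The skew coupling by `√λ` cancels in the energy, and damping only decreases it. The bound is
uniform in `λ`, as the multipliers require. -/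
theorem sum_sq_oscFlow_le {α lam t : ℝ} (hα : 0 ≤ α) (hlam : 0 ≤ lam) (ht : 0 ≤ t) (j : Fin 2) :
    oscFlow α lam t 0 j ^ 2 + oscFlow α lam t 1 j ^ 2 ≤ 1 := by
  have hd : ∀ t, HasDerivAt (fun t => oscFlow α lam t 0 j ^ 2 + oscFlow α lam t 1 j ^ 2)
      (-(2 * (α * lam) * oscFlow α lam t 1 j ^ 2)) t := by
    intro t
    refine (((hasDerivAt_oscFlow_left α lam t 0 j).pow 2).add
      ((hasDerivAt_oscFlow_left α lam t 1 j).pow 2)).congr_deriv ?_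
    simp only [Matrix.mul_apply, Fin.sum_univ_two, oscMatrix, Matrix.of_apply, Matrix.cons_val_zero,
      Matrix.cons_val_one]
    push_cast
    ring
  have hanti := antitone_of_hasDerivAt_nonpos hd fun t => by
    have : 0 ≤ 2 * (α * lam) * oscFlow α lam t 1 j ^ 2 := by positivity
    simpa using this
  refine (hanti ht).trans ?_
  obtain rfl | rfl : j = 0 ∨ j = 1 := by fin_cases j <;> simp
  all_goals simp [oscFlow_zero]

theorem abs_oscFlow_le_one {α lam t : ℝ} (hα : 0 ≤ α) (hlam : 0 ≤ lam) (ht : 0 ≤ t)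
    (i j : Fin 2) : |oscFlow α lam t i j| ≤ 1 := by
  have h := sum_sq_oscFlow_le hα hlam ht j
  rw [← sq_le_one_iff_abs_le_one]
  fin_cases i
  · exact le_trans (le_add_of_nonneg_right (sq_nonneg _)) h
  · exact le_trans (le_add_of_nonneg_left (sq_nonneg _)) h

/-- The matrix is applied to the data before the flow, so that for `w = 𝐀z` the inner sum is a
component of `w`. -/
theorem hasDerivAt_sum_oscFlow_smul {𝕜 X : Type*} [RCLike 𝕜] [NormedAddCommGroup X]
    [NormedSpace 𝕜 X] [NormedSpace ℝ X] [IsScalarTower ℝ 𝕜 X] (α lam t : ℝ) (i : Fin 2)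
    (y : Fin 2 → X) :
    HasDerivAt (fun t => ∑ j, (oscFlow α lam t i j : 𝕜) • y j)
      (∑ j, (oscFlow α lam t i j : 𝕜) • ∑ k, (oscMatrix α lam j k : 𝕜) • y k) t := by
  have h : HasDerivAt (fun t => ∑ j, oscFlow α lam t i j • y j)
      (∑ j, (oscFlow α lam t * oscMatrix α lam) i j • y j) t :=
    HasDerivAt.fun_sum fun j _ => (hasDerivAt_oscFlow α lam t i j).smul_const (y j)
  simp only [← RCLike.real_smul_eq_coe_smul (K := 𝕜)]
  refine h.congr_deriv ?_
  simp only [Fin.sum_univ_two, Matrix.mul_apply]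
  module

namespace PosOp

variable {𝕜 X : Type*} [RCLike 𝕜] [NormedAddCommGroup X] [InnerProductSpace 𝕜 X]
  [CompleteSpace X] (A : PosOp 𝕜 X)

/-! ### Spectral multipliers -/

theorem exists_multiplier {m : ℝ → ℝ} {C : ℝ} (hm : ∀ lam, 0 < lam → |m lam| ≤ C) :
    ∃ Φ : X →L[𝕜] X, ∀ lam, 0 < lam → ∀ x, A.proj lam (Φ x) = (m lam : 𝕜) • A.proj lam x := by
  have hC : 0 ≤ C := (abs_nonneg _).trans (hm 1 one_pos)
  have hle : ∀ x lam, ‖(m lam : 𝕜) • A.proj lam x‖ ^ 2 ≤ C ^ 2 * ‖A.proj lam x‖ ^ 2 := by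
    intro x lam
    rcases le_or_gt lam 0 with h0 | h0
    · simp [A.proj_eq_zero h0]
    · rw [norm_smul, mul_pow, RCLike.norm_ofReal]
      have := hm lam h0
      gcongr
  have hex : ∀ x, ∃ y, ∀ lam, A.proj lam y = (m lam : 𝕜) • A.proj lam x := fun x =>
    A.exists_proj_eq (fun lam => Submodule.smul_mem _ _ (A.proj_mem lam x))
      (Summable.of_nonneg_of_le (fun _ => by positivity) (hle x)
        ((A.summable_norm_proj_sq x).mul_left _))
  choose φ hφ using hex
  let Φ : X →ₗ[𝕜] X :=
    { toFun := φ
      map_add' := fun x y => A.ext_proj fun lam _ => by simp only [hφ, map_add, smul_add]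
      map_smul' := fun c x => A.ext_proj fun lam _ => by
        simp only [hφ, map_smul, RingHom.id_apply, smul_comm c] }
  refine ⟨Φ.mkContinuous C fun x => ?_, fun lam _ x => hφ x lam⟩
  refine (pow_le_pow_iff_left₀ (norm_nonneg _) (by positivity) two_ne_zero).mp ?_
  refine A.norm_sq_le_of_proj fun s => ?_
  rw [mul_pow]
  refine (Finset.sum_le_sum fun lam _ => ?_).trans
    ((Finset.mul_sum _ _ _).symm.trans_le
      (mul_le_mul_of_nonneg_left (A.sum_norm_proj_sq_le x s) (sq_nonneg C)))
  change ‖A.proj lam (φ x)‖ ^ 2 ≤ _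
  rw [hφ]
  exact hle x lam

/-- The two spectral components of an element of the energy space. -/
def comp (lam : ℝ) : Fin 2 → (A.EnergySpace →L[𝕜] X) :=
  ![(A.proj lam).comp ((A.sqrtEquiv : A.XHalf →L[𝕜] X).comp (WithLp.fstL 2 𝕜 A.XHalf X)),
    A.velocityProj lam]

theorem comp_zero_apply (lam : ℝ) (z : A.EnergySpace) :
    A.comp lam 0 z = A.proj lam (A.sqrtMap z.fst) := rfl

theorem comp_one_apply (lam : ℝ) (z : A.EnergySpace) : A.comp lam 1 z = A.proj lam z.snd := rfl

theorem ext_comp {z w : A.EnergySpace} (h : ∀ lam, 0 < lam → ∀ i, A.comp lam i z = A.comp lam i w) :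
    z = w := by
  refine WithLp.ofLp_injective 2 (Prod.ext ?_ ?_)
  · exact A.sqrtOp_injective (A.ext_proj fun lam hlam => h lam hlam 0)
  · exact A.ext_proj fun lam hlam => h lam hlam 1

theorem hasSum_norm_comp_sq (z : A.EnergySpace) :
    HasSum (fun lam => ‖A.comp lam 0 z‖ ^ 2 + ‖A.comp lam 1 z‖ ^ 2) (‖z‖ ^ 2) := by
  rw [WithLp.prod_norm_sq_eq_of_L2]
  exact (A.hasSum_norm_proj_sq (A.sqrtMap z.fst)).add (A.hasSum_norm_proj_sq z.snd)

/-- In the coordinates `(A^{1/2}u, v)` the operator is block diagonal. The domain conditions are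
absorbed into the existence of a `w` in the energy space with these components. -/
theorem mem_graph_hyperbolicOp_iff_comp {α : ℝ} {z w : A.EnergySpace} :
    (z, w) ∈ (A.hyperbolicOp α).graph ↔ ∀ lam, 0 < lam → ∀ i,
      A.comp lam i w = ∑ j, (oscMatrix α lam i j : 𝕜) • A.comp lam j z := by
  have hsqrt : ∀ lam : ℝ, 0 < lam → (lam : 𝕜) = (Real.sqrt lam : 𝕜) * (Real.sqrt lam : 𝕜) := by
    intro lam hlam
    rw [← RCLike.ofReal_mul, Real.mul_self_sqrt hlam.le]
  constructor
  · intro h lam hlam i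
    fin_cases i
    · simp only [Fin.zero_eta, Fin.sum_univ_two, oscMatrix, Matrix.of_apply, Matrix.cons_val_zero,
        Matrix.cons_val_one, RCLike.ofReal_zero, zero_smul, zero_add, comp_zero_apply,
        comp_one_apply]
      rw [A.proj_sqrtMap, (A.mem_graph_hyperbolicOp.mp h).1]
    · have h2 : A.proj lam w.snd = -(((α * lam : ℝ) : 𝕜) • A.proj lam z.snd
          + (lam : 𝕜) • A.projHalf lam z.fst) := A.velocityProj_of_mem_graph lam h
      simp only [Fin.mk_one, Fin.sum_univ_two, oscMatrix, Matrix.of_apply, Matrix.cons_val_zero,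
        Matrix.cons_val_one, comp_zero_apply, comp_one_apply, RCLike.ofReal_neg, neg_smul]
      rw [h2, A.projHalf_apply, A.proj_sqrtMap, smul_smul, ← hsqrt lam hlam, neg_add, add_comm]
  · intro h
    refine A.mem_graph_hyperbolicOp.mpr ⟨A.ext_proj fun lam hlam => ?_,
      A.mem_op_domain_of_proj fun lam hlam => ?_⟩
    · have h1 := h lam hlam 0
      simp only [Fin.sum_univ_two, oscMatrix, Matrix.of_apply, Matrix.cons_val_zero,
        Matrix.cons_val_one, RCLike.ofReal_zero, zero_smul, zero_add, comp_zero_apply,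
        comp_one_apply, A.proj_sqrtMap] at h1
      have hl : (Real.sqrt lam : 𝕜) ≠ 0 := by exact_mod_cast (Real.sqrt_pos.mpr hlam).ne'
      exact smul_right_injective X hl h1
    · have h1 := h lam hlam 1
      simp only [Fin.sum_univ_two, oscMatrix, Matrix.of_apply, Matrix.cons_val_zero,
        Matrix.cons_val_one, comp_zero_apply, comp_one_apply, A.proj_sqrtMap, RCLike.ofReal_neg,
        neg_smul, smul_smul] at h1
      rw [neg_mul, ← hsqrt lam hlam, neg_smul] at h1
      rw [map_neg, h1, map_add, map_smul, smul_add, smul_smul]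
      push_cast
      rw [mul_comm (α : 𝕜)]
      abel

theorem exists_matrix_multiplier {c : ℝ → Matrix (Fin 2) (Fin 2) ℝ} {C : ℝ}
    (hc : ∀ lam, 0 < lam → ∀ i j, |c lam i j| ≤ C) :
    ∃ Φ : A.EnergySpace →L[𝕜] A.EnergySpace, ∀ lam, 0 < lam → ∀ i z,
      A.comp lam i (Φ z) = ∑ j, (c lam i j : 𝕜) • A.comp lam j z := by
  have hex := fun i j => A.exists_multiplier (m := fun lam => c lam i j) fun lam hlam =>
    hc lam hlam i j
  choose Ψ hΨ using hex
  let x : A.EnergySpace →L[𝕜] X :=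
    (A.sqrtEquiv : A.XHalf →L[𝕜] X).comp (WithLp.fstL 2 𝕜 A.XHalf X)
  let v : A.EnergySpace →L[𝕜] X := WithLp.sndL 2 𝕜 A.XHalf X
  let Φ : A.EnergySpace →L[𝕜] A.EnergySpace :=
    ((WithLp.prodContinuousLinearEquiv 2 𝕜 A.XHalf X).symm :
      (A.XHalf × X) →L[𝕜] A.EnergySpace).comp
      (((A.sqrtEquiv.symm : X →L[𝕜] A.XHalf).comp ((Ψ 0 0).comp x + (Ψ 0 1).comp v)).prod
        ((Ψ 1 0).comp x + (Ψ 1 1).comp v))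
  refine ⟨Φ, fun lam hlam i z => ?_⟩
  rw [Fin.sum_univ_two]
  fin_cases i
  · change A.proj lam (A.sqrtEquiv (A.sqrtEquiv.symm (Ψ 0 0 (x z) + Ψ 0 1 (v z)))) = _
    rw [LinearIsometryEquiv.apply_symm_apply, map_add, hΨ _ _ _ hlam, hΨ _ _ _ hlam]
    rfl
  · change A.proj lam (Ψ 1 0 (x z) + Ψ 1 1 (v z)) = _
    rw [map_add, hΨ _ _ _ hlam, hΨ _ _ _ hlam]
    rfl

/-! ### The semigroup of the damped wave equation -/

section Generation

variable {α : ℝ} {S : NNReal → A.EnergySpace →L[𝕜] A.EnergySpace}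

theorem isC0Semigroup_of_comp (hα : 0 ≤ α) (hS : ∀ t : NNReal, ∀ lam, 0 < lam → ∀ i z,
    A.comp lam i (S t z) = ∑ j, (oscFlow α lam t i j : 𝕜) • A.comp lam j z) :
    IsC0Semigroup S where
  map_zero := by
    ext1 z
    refine A.ext_comp fun lam hlam i => ?_
    rw [hS 0 lam hlam, NNReal.coe_zero, oscFlow_zero]
    simp [Matrix.one_apply]
  map_add s t := by
    ext1 z
    refine A.ext_comp fun lam hlam i => ?_
    rw [ContinuousLinearMap.comp_apply, hS _ lam hlam, hS _ lam hlam, NNReal.coe_add, oscFlow_add]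
    simp only [hS t lam hlam, Fin.sum_univ_two, Matrix.mul_apply]
    push_cast
    module
  tendsto z := by
    have key : Tendsto (fun t : NNReal => ‖S t z - z‖ ^ 2) (𝓝 0) (𝓝 0) := by
      simp_rw [fun t => (A.hasSum_norm_comp_sq (S t z - z)).tsum_eq.symm]
      have hcomp : ∀ (t : NNReal) lam, 0 < lam → ∀ i, A.comp lam i (S t z - z)
          = (oscFlow α lam t i 0 : 𝕜) • A.comp lam 0 z
            + (oscFlow α lam t i 1 : 𝕜) • A.comp lam 1 z - A.comp lam i z :=
        fun t lam hlam i => by rw [map_sub, hS t lam hlam, Fin.sum_univ_two]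
      have hzero : ∀ lam ≤ 0, ∀ i (y : A.EnergySpace), A.comp lam i y = 0 := by
        intro lam hlam i y
        fin_cases i <;> exact A.proj_eq_zero hlam _
      rw [show (0 : ℝ) = ∑' _ : ℝ, (0 : ℝ) from tsum_zero.symm]
      -- For component norms `a`, `b` of `z`, flow entries bounded by one give `(2a + b)² + (a +
      -- 2b)² ≤ 9(a² + b²)`; the factor 16 is generous.
      refine tendsto_tsum_of_dominated_convergence
        (bound := fun lam => 16 * (‖A.comp lam 0 z‖ ^ 2 + ‖A.comp lam 1 z‖ ^ 2))
        ((A.hasSum_norm_comp_sq z).summable.mul_left 16) (fun lam => ?_)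
        (Eventually.of_forall fun t lam => ?_)
      · rcases le_or_gt lam 0 with h0 | h0
        · simp [hzero lam h0]
        have hlim : ∀ i, Tendsto (fun t : NNReal => A.comp lam i (S t z - z)) (𝓝 0) (𝓝 0) := by
          intro i
          simp_rw [hcomp _ lam h0]
          have hc : ∀ j, Tendsto (fun t : NNReal => (oscFlow α lam t i j : 𝕜)) (𝓝 0)
              (𝓝 (((1 : Matrix (Fin 2) (Fin 2) ℝ) i j : ℝ) : 𝕜)) := fun j => by
            have := (RCLike.continuous_ofReal (K := 𝕜)).comp
              ((continuous_oscFlow α lam i j).comp NNReal.continuous_coe)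
            simpa [oscFlow_zero, Function.comp_def] using this.tendsto 0
          have := (((hc 0).smul_const (A.comp lam 0 z)).add
            ((hc 1).smul_const (A.comp lam 1 z))).sub_const (A.comp lam i z)
          convert this using 2
          obtain rfl | rfl : i = 0 ∨ i = 1 := by fin_cases i <;> simp
          all_goals simp
        simpa using ((hlim 0).norm.pow 2).add ((hlim 1).norm.pow 2)
      · rcases le_or_gt lam 0 with h0 | h0
        · simp [hzero lam h0]
        have hle : ∀ i, ‖A.comp lam i (S t z - z)‖
            ≤ ‖A.comp lam 0 z‖ + ‖A.comp lam 1 z‖ + ‖A.comp lam i z‖ := by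
          intro i
          rw [hcomp t lam h0]
          refine (norm_sub_le _ _).trans (add_le_add_left ((norm_add_le _ _).trans ?_) _)
          rw [norm_smul, norm_smul, RCLike.norm_ofReal, RCLike.norm_ofReal]
          exact add_le_add
            (mul_le_of_le_one_left (norm_nonneg _) (abs_oscFlow_le_one hα h0.le t.2 i 0))
            (mul_le_of_le_one_left (norm_nonneg _) (abs_oscFlow_le_one hα h0.le t.2 i 1))
        rw [Real.norm_of_nonneg (by positivity)]
        have h1 := pow_le_pow_left₀ (norm_nonneg _) (hle 0) 2
        have h2 := pow_le_pow_left₀ (norm_nonneg _) (hle 1) 2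
        nlinarith [sq_nonneg (‖A.comp lam 0 z‖ - ‖A.comp lam 1 z‖)]
    have h2 := (Real.continuous_sqrt.tendsto 0).comp key
    simp only [Function.comp_def, Real.sqrt_sq (norm_nonneg _), Real.sqrt_zero] at h2
    exact tendsto_iff_norm_sub_tendsto_zero.mpr h2

variable [NormedSpace ℝ X] [IsScalarTower ℝ 𝕜 X]

theorem isGenerator_of_comp (hα : 0 ≤ α) (hS : ∀ t : NNReal, ∀ lam, 0 < lam → ∀ i z,
    A.comp lam i (S t z) = ∑ j, (oscFlow α lam t i j : 𝕜) • A.comp lam j z) :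
    IsGenerator (A.hyperbolicOp α) S := by
  have hC0 := A.isC0Semigroup_of_comp hα hS
  intro z w
  rw [A.mem_graph_hyperbolicOp_iff_comp]
  constructor
  · intro h
    -- The fundamental theorem of calculus in each mode; the integral form then gives the difference
    -- quotient in the norm of the energy space.
    have hint : ∀ t : NNReal, S t z - z = ∫ s in (0 : ℝ)..t, S s.toNNReal w := by
      intro t
      refine A.ext_comp fun lam hlam i => ?_
      have hco := hC0.continuous_orbit w
      rw [← ContinuousLinearMap.intervalIntegral_comp_comm _ (hco.intervalIntegrable _ _)]
      have hd : ∀ r : ℝ, HasDerivAt (fun r => ∑ j, (oscFlow α lam r i j : 𝕜) • A.comp lam j z)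
          (∑ j, (oscFlow α lam r i j : 𝕜) • A.comp lam j w) r := fun r => by
        simp only [h lam hlam]
        exact hasDerivAt_sum_oscFlow_smul α lam r i fun j => A.comp lam j z
      have hcont : Continuous fun r : ℝ =>
          ∑ j, (oscFlow α lam r i j : 𝕜) • A.comp lam j w :=
        continuous_finsetSum _ fun j _ =>
          (RCLike.continuous_ofReal.comp (continuous_oscFlow α lam i j)).smul continuous_const
      have hftc := intervalIntegral.integral_eq_sub_of_hasDerivAt (fun r _ => hd r)
        (hcont.intervalIntegrable 0 t)
      rw [map_sub, hS t lam hlam, ← show ∑ j, (oscFlow α lam 0 i j : 𝕜) • A.comp lam j z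
        = A.comp lam i z by simp [oscFlow_zero, Matrix.one_apply], ← hftc]
      refine intervalIntegral.integral_congr fun s hs => ?_
      rw [uIcc_of_le t.coe_nonneg] at hs
      simp only [hS s.toNNReal lam hlam, Real.coe_toNNReal s hs.1]
    have hco := hC0.continuous_orbit w
    have hderiv := intervalIntegral.integral_hasDerivAt_right (hco.intervalIntegrable 0 0)
      (hco.stronglyMeasurableAtFilter _ _) hco.continuousAt
    have hlim := (hasDerivAt_iff_tendsto_slope_zero.mp hderiv).comp tendsto_coe_nhdsGT_zero
    simp only [Real.toNNReal_zero, hC0.map_zero, ContinuousLinearMap.id_apply] at hlim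
    refine hlim.congr fun t => ?_
    simp only [Function.comp, zero_add, intervalIntegral.integral_same, sub_zero]
    rw [hint, RCLike.real_smul_eq_coe_smul (K := 𝕜), RCLike.ofReal_inv]
  · intro h lam hlam i
    have h1 := ((A.comp lam i).continuous.tendsto w).comp h
    -- Conversely, each component of the limit must be the derivative at zero of the flow of that
    -- mode.
    refine tendsto_nhds_unique h1 ?_
    have hd := hasDerivAt_sum_oscFlow_smul (𝕜 := 𝕜) α lam 0 i fun j => A.comp lam j z
    have hlim := (hasDerivAt_iff_tendsto_slope_zero.mp hd).comp tendsto_coe_nhdsGT_zero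
    have h0 : ∀ y : Fin 2 → X, ∑ j, (oscFlow α lam 0 i j : 𝕜) • y j = y i := fun y => by
      simp [oscFlow_zero, Matrix.one_apply]
    rw [h0 fun j => A.comp lam j z, h0] at hlim
    refine hlim.congr fun t => ?_
    simp only [Function.comp, zero_add]
    rw [map_smul, map_sub, hS t lam hlam,
      RCLike.real_smul_eq_coe_smul (K := 𝕜), RCLike.ofReal_inv]

/-- The hyperbolic operator generates a `C₀`-semigroup. -/
theorem exists_semigroup_hyperbolicOp (hα : 0 ≤ α) :
    ∃ S : NNReal → A.EnergySpace →L[𝕜] A.EnergySpace,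
      IsC0Semigroup S ∧ IsGenerator (A.hyperbolicOp α) S := by
  have hex := fun t : NNReal => A.exists_matrix_multiplier (c := fun lam => oscFlow α lam t)
    fun lam hlam i j => abs_oscFlow_le_one hα hlam.le t.2 i j
  choose S hS using hex
  exact ⟨S, A.isC0Semigroup_of_comp hα hS, A.isGenerator_of_comp hα hS⟩

end Generation

end PosOp

end DampedWave

end

/-! ### The lower bound for the period -/

theorem theorem1p4 {𝕜 X : Type*} [RCLike 𝕜] [NormedAddCommGroup X] [InnerProductSpace 𝕜 X]
    [CompleteSpace X] [TopologicalSpace.SeparableSpace X] [NormedSpace ℝ X] [IsScalarTower ℝ 𝕜 X]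
    (A : DampedWave.PosOp 𝕜 X) (α : ℝ) (hα : 0 < α) (f : A.XHalf → X → X) (L : ℝ) (hL : 0 < L)
    (hf : ∀ (u₁ u₂ : A.XHalf) (v₁ v₂ : X),
      ‖f u₁ v₁ - f u₂ v₂‖ ≤ L * Real.sqrt (‖u₁ - u₂‖ ^ 2 + ‖v₁ - v₂‖ ^ 2))
    (T : ℝ) (hT : 0 < T) (u : ℝ → A.XHalf) (v : ℝ → X)
    (hsol : A.IsWaveSolution α f (Icc 0 T) u v)
    (hperiodic : u T = u 0 ∧ v T = v 0)
    (hnonstationary : ∃ t ∈ Icc 0 T, u t ≠ u 0) :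
    1 / (L * (1 + Real.sqrt ((1 + 1 / Real.sqrt 2) * (1 + 2 / (α * L)))) ^ 2) ≤ T := by
  by_contra! hlt
  obtain ⟨t, ht, hne⟩ := hnonstationary
  exact hne (A.period_bound hα (A.exists_semigroup_hyperbolicOp hα.le) hL hf hT hsol hperiodic.1
    hperiodic.2 (DampedWave.mul_le_one_of_lt_bound hα hL hlt) t ht)
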